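/- For $l \ge 1$ let $$\mathsf{BS}^{(l)} = \langle a_0,\dots,a_l \mid a_{i-1}a_i = a_i a_{i-1}^2,\ i=1,\dots,l\rangle .$$ Words are finite strings in the letters $a_i$, $a_i^{-1}$ and an identity character $e$; the length $|w|$ of a word is its number of letters (occurrences of $e$ included), and $K_{e,L}$ is the set of words of length $L$ that represent the identity of $\mathsf{BS}^{(l)}$. A derivation $D$ from $w$ to $w'$ is a sequence of words $w\to u_1\to\cdots\to u_n\to w'$ in which every arrow applies a single relation to a subword, in either direction; the relations are the defining ones and the trivial ones $xx^{-1}=e$ (for $x=a_i^{\pm1}$) and $xe=x$, $ex=x$, $xe=ex$ (for every letter $x$). Let $\mathsf{Dehn}(w,w')$ be the minimal number of arrows of a derivation from $w$ to $w'$, and let $\mathsf{EL}(w,w')$ be the minimum, over all derivations from $w$ to $w'$, of the maximal length of a word occurring in the derivation. Put $$\mathsf{Dehn}(L)=\max_{w,w'\in K_{e,L}}\mathsf{Dehn}(w,w'),\qquad \mathsf{EL}(L)=\max_{w,w'\in K_{e,L}}\mathsf{EL}(w,w').$$ Then $$\mathsf{Dehn}(L)\sim\exp^{(l)}(L),\qquad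 \mathsf{EL}(L)\sim\exp^{(l-1)}(L),$$ where $\exp^{(k)}$ is the $k$-fold iterate of $\exp$ (with $\exp^{(0)}(L)=L$), and $f(L)\sim g(L)$ means that there is a constant $C>0$ (which may depend on $l$) such that $g(L/C)\le f(L)\le g(CL)$ for all sufficiently large integers $L$. -/

import Mathlib

namespace WordProblem

/-! ### Derivations over an alphabet `S` with a set `R` of relations `r.1 = r.2` -/

/-- `w → w'` by a single application, in either direction and at any place, of a relation in `R`. -/
def Step {S : Type} (R : Set (List S × List S)) (w w' : List S) : Prop :=
  ∃ u v : List S, ∃ r ∈ R,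
    (w = u ++ r.1 ++ v ∧ w' = u ++ r.2 ++ v) ∨ (w = u ++ r.2 ++ v ∧ w' = u ++ r.1 ++ v)

/-- Derivations `w → u₁ → ⋯ → uₙ → w'`, every arrow being a single application of a relation. -/
inductive Derivation {S : Type} (R : Set (List S × List S)) : List S → List S → Type
  | nil (w : List S) : Derivation R w w
  | cons (w : List S) {u w' : List S} (h : Step R w u) (D : Derivation R u w') :
      Derivation R w w'

/-- The number of arrows of a derivation. -/
def Derivation.steps {S : Type} {R : Set (List S × List S)} :
    {w w' : List S} → Derivation R w w' → ℕ
  | _, _, .nil _ => 0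
  | _, _, .cons _ _ D => D.steps + 1

/-- The expansion length of a derivation: the maximal length of a word occurring in it. -/
def Derivation.maxLength {S : Type} {R : Set (List S × List S)} :
    {w w' : List S} → Derivation R w w' → ℕ
  | _, _, .nil w => w.length
  | _, _, .cons w _ D => max w.length D.maxLength

/-- `Dehn(w, w')`: the minimal number of steps of a derivation (`⊤` if there is none). -/
noncomputable def dehn {S : Type} (R : Set (List S × List S)) (w w' : List S) : ℕ∞ :=
  ⨅ D : Derivation R w w', (D.steps : ℕ∞)

/-- `EL(w, w')`: the minimal expansion length of a derivation (`⊤` if there is none). -/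
noncomputable def expansionLength {S : Type} (R : Set (List S × List S)) (w w' : List S) : ℕ∞ :=
  ⨅ D : Derivation R w w', (D.maxLength : ℕ∞)

/-! ### Group presentations

A group presentation on the generators `α` is a set `P` of relations `r.1 = r.2` between words in
the generators `(x, true)` and their inverses `(x, false)`. -/

/-- The relators `r.1 r.2⁻¹` of `P`, as elements of the free group. -/
def relators {α : Type} (P : Set (List (α × Bool) × List (α × Bool))) : Set (FreeGroup α) :=
  {g | ∃ r ∈ P, g = FreeGroup.mk r.1 * (FreeGroup.mk r.2)⁻¹}

/-- The group presented by `P`. -/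
abbrev PresGroup {α : Type} (P : Set (List (α × Bool) × List (α × Bool))) : Type :=
  PresentedGroup (relators P)

/-- The letters from which words are formed: the generators and their inverses (`some`), and the
identity character `e` (`none`), which counts towards the length of a word. -/
abbrev Letter (α : Type) : Type := Option (α × Bool)

/-- The relations of `P`, together with the trivial relations `x x⁻¹ = e`, `x e = x`, `e x = x` and
`x e = e x` which are left implicit in a group presentation. -/
def allRelations {α : Type} (P : Set (List (α × Bool) × List (α × Bool))) :
    Set (List (Letter α) × List (Letter α)) :=
  {q | (∃ r ∈ P, q = (r.1.map some, r.2.map some)) ∨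
    (∃ x : α × Bool, q = ([some x, some (x.1, !x.2)], [none])) ∨
    (∃ x : Letter α, q = ([x, none], [x])) ∨
    (∃ x : Letter α, q = ([none, x], [x])) ∨
    (∃ x : Letter α, q = ([x, none], [none, x]))}

/-- The group element represented by a letter. -/
def letterValue {α : Type} (P : Set (List (α × Bool) × List (α × Bool))) : Letter α → PresGroup P
  | none => 1
  | some (x, true) => PresentedGroup.of x
  | some (x, false) => (PresentedGroup.of x)⁻¹

/-- `φ(w)`: the group element represented by a word. -/
def eval {α : Type} (P : Set (List (α × Bool) × List (α × Bool))) (w : List (Letter α)) :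
    PresGroup P :=
  (w.map (letterValue P)).prod

/-- `K_{g,L}`: the words of length `L` that represent `g`. -/
def sector {α : Type} (P : Set (List (α × Bool) × List (α × Bool))) (g : PresGroup P) (L : ℕ) :
    Set (List (Letter α)) :=
  {w | eval P w = g ∧ w.length = L}

/-- `Dehn_g(L)`, the maximum of `Dehn(w, w')` over `w, w' ∈ K_{g,L}`. -/
noncomputable def dehnSector {α : Type} (P : Set (List (α × Bool) × List (α × Bool)))
    (g : PresGroup P) (L : ℕ) : ℕ∞ :=
  ⨆ w ∈ sector P g L, ⨆ w' ∈ sector P g L, dehn (allRelations P) w w'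

/-- `EL_g(L)`, the maximum of `EL(w, w')` over `w, w' ∈ K_{g,L}`. -/
noncomputable def expansionLengthSector {α : Type}
    (P : Set (List (α × Bool) × List (α × Bool))) (g : PresGroup P) (L : ℕ) : ℕ∞ :=
  ⨆ w ∈ sector P g L, ⨆ w' ∈ sector P g L, expansionLength (allRelations P) w w'

/-- The Dehn function `Dehn(L) = Dehn_e(L)` of a group presentation. -/
noncomputable def dehnFunction {α : Type} (P : Set (List (α × Bool) × List (α × Bool)))
    (L : ℕ) : ℕ∞ :=
  dehnSector P 1 L

/-- The expansion length function `EL(L) = EL_e(L)` of a group presentation. -/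
noncomputable def expansionLengthFunction {α : Type}
    (P : Set (List (α × Bool) × List (α × Bool))) (L : ℕ) : ℕ∞ :=
  expansionLengthSector P 1 L

/-- `f(L) ∼ g(L)` in the scaling sense: for some constant `C > 0`,
`g(L / C) ≤ f(L) ≤ g(C L)` for all sufficiently large `L`. -/
def ScalesAs (f : ℕ → ℕ∞) (g : ℝ → ℝ) : Prop :=
  ∃ C : ℝ, 0 < C ∧ ∀ᶠ L : ℕ in Filter.atTop,
    ENNReal.ofReal (g ((L : ℝ) / C)) ≤ ((f L : ℕ∞) : ENNReal) ∧
      ((f L : ℕ∞) : ENNReal) ≤ ENNReal.ofReal (g (C * (L : ℝ)))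

/-- The presentation `⟨a₀, …, a_l | a_{i-1} a_i = a_i a_{i-1}², i = 1, …, l⟩` of the `l`-fold
iterated Baumslag–Solitar group; `i : Fin l` stands for the index `i + 1`. -/
def iteratedBS (l : ℕ) : Set (List (Fin (l + 1) × Bool) × List (Fin (l + 1) × Bool)) :=
  {r | ∃ i : Fin l, r = ([(i.castSucc, true), (i.succ, true)],
    [(i.succ, true), (i.castSucc, true), (i.castSucc, true)])}

end WordProblem

/-! Let l = n + 1. The theorem rests on two estimates, with an n-fold tower T of powers of two in a
linear function of L. Trivial words of length L can be contracted through words of length at most T,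
and some of them need at least about 2 ^ T steps. Over q letters there are at most (q + 1) ^ N words
of length at most N, so space N suffices for a derivation with (q + 1) ^ N steps
(`dehn_le_of_conn`). By this count the space estimate also gives the upper bound for Dehn, and the
step estimate also gives the lower bound for EL.

The space estimate is proved by induction on the number of generators. For BS(1,2), the affine group
of ℤ[1/2], a word is read letter by letter and kept in the normal form a₁^L a₀^N a₁^(-m), with a₀^N
spelled in binary, so linear space is enough (`affineModel_fills`). Every further generator t is the
stable letter of an HNN extension with t a² t⁻¹ = a, where a is the previous generator. Britton's
lemma finds in a trivial word a pinch t^{±1} V t^{∓1} with V a suitable power of a. A homomorphism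
to ℤ bounds the exponent by |V|, so removing the pinch at most doubles the word. At most L pinches
occur, so lengths reach 2^L L and each generator costs one exponential (`BSModel.Fills.succ`).

The step estimate comes from a discrete area. The a₀-edges of the Cayley graph carry weights for
which the total weight of a path changes by at most one per derivation step
(`abs_flux_sub_le_of_step`). Iterated conjugation spells a₁^T with T = `tower n m` in O(m) letters,
so the commutator of a₁^(-T) a₀ a₁^T = a₀^(2^T) with a₀ is a short trivial word; its total weight is
2^(T-1) (`exists_hard_word`). -/

namespace WordProblem

/-! ### Words connected in bounded space -/

/-- `w` and `w'` are joined by a derivation, all of whose words have length at most `N`. -/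
def Conn {S : Type} (R : Set (List S × List S)) (N : ℕ) : List S → List S → Prop :=
  Relation.ReflTransGen fun w w' => Step R w w' ∧ w.length ≤ N ∧ w'.length ≤ N

section Conn

variable {S T : Type} {R : Set (List S × List S)} {R' : Set (List T × List T)} {N M : ℕ}
  {w w' w'' : List S}

theorem Step.symm (h : Step R w w') : Step R w' w := by
  obtain ⟨u, v, r, hr, h | h⟩ := h
  · exact ⟨u, v, r, hr, .inr h.symm⟩
  · exact ⟨u, v, r, hr, .inl h.symm⟩

theorem Conn.refl (w : List S) : Conn R N w w := Relation.ReflTransGen.refl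

theorem Conn.of_eq (h : w = w') : Conn R N w w' := h ▸ Conn.refl w

theorem Conn.trans (h : Conn R N w w') (h' : Conn R N w' w'') : Conn R N w w'' :=
  Relation.ReflTransGen.trans h h'

theorem Conn.symm (h : Conn R N w w') : Conn R N w' w := by
  induction h with
  | refl => exact .refl _
  | tail _ hs ih => exact (Relation.ReflTransGen.single ⟨hs.1.symm, hs.2.2, hs.2.1⟩).trans ih

theorem Conn.mono (h : Conn R N w w') (hN : N ≤ M) : Conn R M w w' :=
  Relation.ReflTransGen.mono (fun _ _ h => ⟨h.1, h.2.1.trans hN, h.2.2.trans hN⟩) _ _ h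

theorem Conn.of_step (h : Step R w w') (hw : w.length ≤ N) (hw' : w'.length ≤ N) :
    Conn R N w w' :=
  .single ⟨h, hw, hw'⟩

theorem Conn.of_rel {r : List S × List S} (hr : r ∈ R) (h1 : r.1.length ≤ N)
    (h2 : r.2.length ≤ N) : Conn R N r.1 r.2 :=
  .of_step ⟨[], [], r, hr, .inl (by simp)⟩ h1 h2

theorem Conn.simulate (f : List S → List T)
    (hf : ∀ w w', Step R w w' → w.length ≤ N → w'.length ≤ N → Conn R' M (f w) (f w'))
    (h : Conn R N w w') : Conn R' M (f w) (f w') := by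
  induction h with
  | refl => exact .refl _
  | tail _ hs ih => exact ih.trans (hf _ _ hs.1 hs.2.1 hs.2.2)

theorem Step.context (h : Step R w w') (u v : List S) : Step R (u ++ w ++ v) (u ++ w' ++ v) := by
  obtain ⟨a, b, r, hr, ⟨rfl, rfl⟩ | ⟨rfl, rfl⟩⟩ := h
  · exact ⟨u ++ a, b ++ v, r, hr, .inl (by simp)⟩
  · exact ⟨u ++ a, b ++ v, r, hr, .inr (by simp)⟩

theorem Conn.context (h : Conn R N w w') (u v : List S) (hM : u.length + N + v.length ≤ M) :
    Conn R M (u ++ w ++ v) (u ++ w' ++ v) :=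
  h.simulate (fun w => u ++ w ++ v) fun w w' hs h1 h2 =>
    .of_step (hs.context u v) (by simp; omega) (by simp; omega)

theorem Conn.append_left (h : Conn R N w w') (u : List S) (hM : u.length + N ≤ M) :
    Conn R M (u ++ w) (u ++ w') := by
  simpa using h.context u [] (M := M) (by simpa using hM)

theorem Conn.append_right (h : Conn R N w w') (v : List S) (hM : N + v.length ≤ M) :
    Conn R M (w ++ v) (w' ++ v) := by
  simpa using h.context [] v (M := M) (by simpa using hM)

theorem Conn.exists_derivation (h : Conn R N w w') (hw : w.length ≤ N) :
    ∃ D : Derivation R w w', D.maxLength ≤ N := by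
  induction h using Relation.ReflTransGen.head_induction_on with
  | refl => exact ⟨.nil _, hw⟩
  | head hs _ ih =>
    obtain ⟨D, hD⟩ := ih hs.2.2
    exact ⟨.cons _ hs.1 D, max_le hw hD⟩

theorem Derivation.length_le_maxLength : ∀ {w w' : List S} (D : Derivation R w w'),
    w.length ≤ D.maxLength
  | _, _, .nil _ => le_rfl
  | _, _, .cons _ _ _ => le_max_left _ _

theorem Derivation.conn : ∀ {w w' : List S} (D : Derivation R w w'), Conn R D.maxLength w w'
  | _, _, .nil _ => .refl _
  | _, _, .cons _ h D =>
    .trans (.of_step h (le_max_left _ _) (D.length_le_maxLength.trans (le_max_right _ _)))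
      (D.conn.mono (le_max_right _ _))

theorem expansionLength_le (h : Conn R N w w') (hw : w.length ≤ N) :
    expansionLength R w w' ≤ N := by
  obtain ⟨D, hD⟩ := h.exists_derivation hw
  exact (iInf_le _ D).trans (by exact_mod_cast hD)

/-- Words of length at most `N`, two of them being adjacent if a single step joins them. -/
def stepGraph (R : Set (List S × List S)) (N : ℕ) : SimpleGraph {w : List S // w.length ≤ N} where
  Adj a b := a ≠ b ∧ Step R a.1 b.1
  symm := ⟨fun _ _ h => ⟨h.1.symm, h.2.symm⟩⟩
  loopless := ⟨fun _ h => h.1 rfl⟩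

theorem exists_derivation_of_walk : ∀ {a b : {w : List S // w.length ≤ N}}
    (p : (stepGraph R N).Walk a b), ∃ D : Derivation R a.1 b.1, D.steps = p.length
  | _, _, .nil => ⟨.nil _, rfl⟩
  | _, _, .cons h p => by
    obtain ⟨D, hD⟩ := exists_derivation_of_walk p
    exact ⟨.cons _ h.2 D, by simp [Derivation.steps, hD]⟩

theorem Conn.reachable (h : Conn R N w w') (hw : w.length ≤ N) :
    ∃ hw' : w'.length ≤ N, (stepGraph R N).Reachable ⟨w, hw⟩ ⟨w', hw'⟩ := by
  induction h with
  | refl => exact ⟨hw, .refl _⟩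
  | @tail b c _ hs ih =>
    obtain ⟨hb, hr⟩ := ih
    refine ⟨hs.2.2, hr.trans ?_⟩
    by_cases hbc : b = c
    · subst hbc; exact .refl _
    · exact SimpleGraph.Adj.reachable ⟨by simpa using hbc, hs.1⟩

theorem card_words_le [Finite S] (N : ℕ) :
    Finite {w : List S // w.length ≤ N} ∧
      Nat.card {w : List S // w.length ≤ N} ≤ (Nat.card S + 1) ^ N := by
  have hinj : Function.Injective
      (fun (w : {w : List S // w.length ≤ N}) (i : Fin N) => w.1[i.1]?) := by
    rintro ⟨w, hw⟩ ⟨w', hw'⟩ h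
    simp only [Subtype.mk.injEq]
    refine List.ext_getElem? fun i => ?_
    by_cases hi : i < N
    · exact congrFun h ⟨i, hi⟩
    · rw [List.getElem?_eq_none (by omega), List.getElem?_eq_none (by omega)]
  refine ⟨Finite.of_injective _ hinj, (Nat.card_le_card_of_injective _ hinj).trans ?_⟩
  rw [Nat.card_fun, Finite.card_option, Nat.card_fin]

/-- A shortest derivation in space `N` repeats no word, so it has fewer steps than there are words
of length at most `N`. This is the link between time and space in both directions. -/
theorem dehn_le_of_conn [Finite S] (h : Conn R N w w') (hw : w.length ≤ N) :
    dehn R w w' ≤ ((Nat.card S + 1) ^ N : ℕ) := by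
  classical
  obtain ⟨hw', hr⟩ := h.reachable hw
  obtain ⟨hfin, hcard⟩ := card_words_le (S := S) N
  obtain ⟨p, hp⟩ := hr.exists_isPath
  obtain ⟨D, hD⟩ := exists_derivation_of_walk p
  have := Fintype.ofFinite {w : List S // w.length ≤ N}
  have hlt := hp.length_lt
  rw [← Nat.card_eq_fintype_card] at hlt
  refine (iInf_le _ D).trans ?_
  rw [hD]
  exact_mod_cast hlt.le.trans hcard

end Conn

/-! ### Words in the generators and their inverses -/

section Words

variable {α β : Type} {P : Set (List (α × Bool) × List (α × Bool))} {N M : ℕ}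

/-- The relations of `P` together with the free cancellations `x x⁻¹ = 1`. -/
def freeRelations (P : Set (List (α × Bool) × List (α × Bool))) :
    Set (List (α × Bool) × List (α × Bool)) :=
  P ∪ {q | ∃ x : α × Bool, q = ([x, (x.1, !x.2)], [])}

theorem conn_cancel_letter (x : α × Bool) : Conn (freeRelations P) 2 [x, (x.1, !x.2)] [] :=
  Conn.of_rel (r := ([x, (x.1, !x.2)], [])) (.inr ⟨x, rfl⟩) (by simp) (by simp)

theorem conn_append_invRev (w : List (α × Bool)) (hN : 2 * w.length ≤ N) :
    Conn (freeRelations P) N (w ++ FreeGroup.invRev w) [] := by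
  induction w generalizing N with
  | nil => exact .refl _
  | cons x w ih =>
    rw [FreeGroup.invRev_cons]
    simp only [List.length_cons] at hN
    have h1 := (ih le_rfl).context [x] [(x.1, !x.2)] (M := N) (by simp; omega)
    refine Conn.trans (.of_eq ?_) (h1.trans ?_)
    · simp [FreeGroup.invRev]
    · exact (conn_cancel_letter x).mono (by omega)

theorem conn_invRev_append (w : List (α × Bool)) (hN : 2 * w.length ≤ N) :
    Conn (freeRelations P) N (FreeGroup.invRev w ++ w) [] := by
  simpa using conn_append_invRev (P := P) (FreeGroup.invRev w) (N := N) (by simpa using hN)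

/-- The word `x ^ k`. -/
def power (x : α) (k : ℤ) : List (α × Bool) := List.replicate k.natAbs (x, decide (0 ≤ k))

@[simp] theorem length_power (x : α) (k : ℤ) : (power x k).length = k.natAbs := by simp [power]

@[simp] theorem power_zero (x : α) : power x 0 = [] := by simp [power]

@[simp] theorem power_one (x : α) : power x 1 = [(x, true)] := by simp [power]

@[simp] theorem power_neg_one (x : α) : power x (-1) = [(x, false)] := by simp [power]

@[simp] theorem invRev_power (x : α) (k : ℤ) : FreeGroup.invRev (power x k) = power x (-k) := by
  rcases eq_or_ne k 0 with rfl | hk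
  · simp [FreeGroup.invRev]
  · have : (!decide (0 ≤ k)) = decide (k ≤ 0) := by
      rw [← decide_not]; exact decide_eq_decide.2 (by omega)
    simp [power, FreeGroup.invRev, this]

theorem power_add_of_mul_nonneg (x : α) {j k : ℤ} (h : 0 ≤ j * k) :
    power x (j + k) = power x j ++ power x k := by
  rcases eq_or_ne j 0 with rfl | hj
  · simp
  rcases eq_or_ne k 0 with rfl | hk
  · simp
  have : (0 < j ∧ 0 < k) ∨ (j < 0 ∧ k < 0) := by
    rcases lt_or_gt_of_ne hj with h1 | h1 <;> rcases lt_or_gt_of_ne hk with h2 | h2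
    · exact .inr ⟨h1, h2⟩
    · nlinarith
    · nlinarith
    · exact .inl ⟨h1, h2⟩
  rcases this with ⟨h1, h2⟩ | ⟨h1, h2⟩
  · simp only [power]
    rw [decide_eq_true (by omega : 0 ≤ j + k), decide_eq_true h1.le, decide_eq_true h2.le,
      List.replicate_append_replicate, show (j + k).natAbs = j.natAbs + k.natAbs by omega]
  · simp only [power]
    rw [decide_eq_false (by omega : ¬ 0 ≤ j + k), decide_eq_false (by omega : ¬ 0 ≤ j),
      decide_eq_false (by omega : ¬ 0 ≤ k),
      List.replicate_append_replicate, show (j + k).natAbs = j.natAbs + k.natAbs by omega]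

theorem conn_power_add (x : α) (j k : ℤ) (hN : j.natAbs + k.natAbs ≤ N) :
    Conn (freeRelations P) N (power x j ++ power x k) (power x (j + k)) := by
  rcases le_total 0 (j * k) with h | h
  · exact .of_eq (power_add_of_mul_nonneg x h).symm
  rcases le_total k.natAbs j.natAbs with hjk | hjk
  · have hsplit : power x j = power x (j + k) ++ power x (-k) := by
      rw [← power_add_of_mul_nonneg x]
      · ring_nf
      · rcases mul_nonpos_iff.1 h with ⟨h1, h2⟩ | ⟨h1, h2⟩
        · exact mul_nonneg (by omega) (by omega)
        · exact mul_nonneg_of_nonpos_of_nonpos (by omega) (by omega)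
    rw [hsplit, List.append_assoc]
    have h1 := conn_invRev_append (P := P) (power x k) (N := 2 * k.natAbs) (by simp)
    rw [invRev_power] at h1
    simpa using h1.append_left (power x (j + k)) (M := N) (by
      have : (power x (j + k)).length + (power x (-k)).length = j.natAbs := by
        rw [← length_power x j, hsplit, List.length_append]
      simp only [length_power, Int.natAbs_neg] at this ⊢
      omega)
  · have hsplit : power x k = power x (-j) ++ power x (j + k) := by
      rw [← power_add_of_mul_nonneg x]
      · ring_nf
      · rcases mul_nonpos_iff.1 h with ⟨h1, h2⟩ | ⟨h1, h2⟩
        · exact mul_nonneg_of_nonpos_of_nonpos (by omega) (by omega)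
        · exact mul_nonneg (by omega) (by omega)
    rw [hsplit, ← List.append_assoc]
    have h1 := conn_append_invRev (P := P) (power x j) (N := 2 * j.natAbs) (by simp)
    rw [invRev_power] at h1
    simpa using h1.append_right (power x (j + k)) (M := N) (by
      have : (power x (-j)).length + (power x (j + k)).length = k.natAbs := by
        rw [← length_power x k, hsplit, List.length_append]
      simp only [length_power, Int.natAbs_neg] at this ⊢
      omega)

/-- Renaming the generators of a word. -/
def rename (f : α → β) (w : List (α × Bool)) : List (β × Bool) := w.map fun x => (f x.1, x.2)

@[simp] theorem length_rename (f : α → β) (w : List (α × Bool)) :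
    (rename f w).length = w.length := by simp [rename]

@[simp] theorem rename_append (f : α → β) (w w' : List (α × Bool)) :
    rename f (w ++ w') = rename f w ++ rename f w' := by simp [rename]

@[simp] theorem rename_power (f : α → β) (x : α) (k : ℤ) :
    rename f (power x k) = power (f x) k := by simp [rename, power]

theorem Conn.rename {Q : Set (List (β × Bool) × List (β × Bool))} {w w' : List (α × Bool)}
    (f : α → β)
    (hf : ∀ r ∈ P, (rename f r.1, rename f r.2) ∈ Q) (h : Conn (freeRelations P) N w w') :
    Conn (freeRelations Q) N (rename f w) (rename f w') := by
  refine h.simulate _ fun w w' hs h1 h2 => .of_step ?_ (by simpa using h1) (by simpa using h2)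
  have key : ∀ r ∈ freeRelations P,
      (WordProblem.rename f r.1, WordProblem.rename f r.2) ∈ freeRelations Q := by
    rintro r (hr | ⟨x, rfl⟩)
    · exact .inl (hf r hr)
    · exact .inr ⟨(f x.1, x.2), by simp [WordProblem.rename]⟩
  obtain ⟨u, v, r, hr, ⟨rfl, rfl⟩ | ⟨rfl, rfl⟩⟩ := hs
  · exact ⟨WordProblem.rename f u, WordProblem.rename f v, _, key r hr, .inl (by simp)⟩
  · exact ⟨WordProblem.rename f u, WordProblem.rename f v, _, key r hr, .inr (by simp)⟩

/-- The value of a word in a group. -/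
def value {G : Type} [Group G] (gen : α → G) (w : List (α × Bool)) : G :=
  FreeGroup.lift gen (FreeGroup.mk w)

section value

variable {G : Type} [Group G] (gen : α → G)

@[simp] theorem value_nil : value gen [] = 1 := by simp [value]

@[simp] theorem value_append (w w' : List (α × Bool)) :
    value gen (w ++ w') = value gen w * value gen w' := by
  rw [value, ← FreeGroup.mul_mk, map_mul, value, value]

@[simp] theorem value_singleton_true (x : α) : value gen [(x, true)] = gen x := by
  simp [value]

@[simp] theorem value_singleton_false (x : α) : value gen [(x, false)] = (gen x)⁻¹ := by
  simp [value]

theorem value_cons (x : α × Bool) (w : List (α × Bool)) :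
    value gen (x :: w) = value gen [x] * value gen w := by
  rw [← value_append]; rfl

@[simp] theorem value_invRev (w : List (α × Bool)) :
    value gen (FreeGroup.invRev w) = (value gen w)⁻¹ := by
  rw [value, ← FreeGroup.inv_mk, map_inv, value]

@[simp] theorem value_power (x : α) (k : ℤ) : value gen (power x k) = gen x ^ k := by
  rcases le_total 0 k with h | h
  · lift k to ℕ using h
    simp [power, value]
  · rw [← neg_neg k, ← invRev_power, value_invRev]
    obtain ⟨j, hj⟩ := Int.eq_ofNat_of_zero_le (neg_nonneg.2 h)
    rw [hj]
    simp [power, value]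

theorem value_rename (f : β → α) (w : List (β × Bool)) :
    value gen (rename f w) = value (gen ∘ f) w := by
  simp [value, rename, Function.comp_def]

theorem map_value {H : Type} [Group H] (φ : G →* H) (w : List (α × Bool)) :
    φ (value gen w) = value (φ ∘ gen) w := by
  simp [value, map_list_prod, Function.comp_def, Bool.apply_cond]

theorem value_eq_of_step {w w' : List (α × Bool)}
    (hP : ∀ r ∈ P, value gen r.1 = value gen r.2)
    (h : Step (freeRelations P) w w') : value gen w = value gen w' := by
  have key : ∀ r ∈ freeRelations P, value gen r.1 = value gen r.2 := by
    rintro r (hr | ⟨⟨x, b⟩, rfl⟩)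
    · exact hP r hr
    · cases b <;> simp [value_cons gen (x, _) [_]]
  obtain ⟨u, v, r, hr, ⟨rfl, rfl⟩ | ⟨rfl, rfl⟩⟩ := h <;> simp [key r hr]

theorem value_eq_of_conn {w w' : List (α × Bool)}
    (hP : ∀ r ∈ P, value gen r.1 = value gen r.2)
    (h : Conn (freeRelations P) N w w') : value gen w = value gen w' := by
  induction h with
  | refl => rfl
  | tail _ hs ih => exact ih.trans (value_eq_of_step gen hP hs.1)

end value

/-! ### The identity character -/

theorem conn_move_none (w : List (Letter α)) (hN : w.length + 1 ≤ N) :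
    Conn (allRelations P) N (none :: w) (w ++ [none]) := by
  induction w generalizing N with
  | nil => exact .refl _
  | cons x w ih =>
    simp only [List.length_cons] at hN
    have h1 : Conn (allRelations P) 2 [none, x] [x, none] :=
      (Conn.of_rel (r := ([x, none], [none, x])) (.inr (.inr (.inr (.inr ⟨x, rfl⟩))))
        (by simp) (by simp)).symm
    have h2 := h1.append_right w (M := N) (by omega)
    have h3 := (ih le_rfl).append_left [x] (M := N) (by simp; omega)
    exact h2.trans h3

theorem conn_append_none {w : List (Letter α)} (hw : w ≠ []) (hN : w.length + 1 ≤ N) :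
    Conn (allRelations P) N w (w ++ [none]) := by
  obtain ⟨u, x, rfl⟩ := List.eq_nil_or_concat'  w |>.resolve_left hw
  have h1 : Conn (allRelations P) 2 [x] [x, none] :=
    (Conn.of_rel (r := ([x, none], [x])) (.inr (.inr (.inl ⟨x, rfl⟩))) (by simp) (by simp)).symm
  simpa using h1.append_left u (M := N) (by simp at hN; omega)

theorem conn_reduceOption (w : List (Letter α)) (hN : w.length + 1 ≤ N) :
    Conn (allRelations P) N (w ++ [none]) (w.reduceOption.map some ++ [none]) := by
  induction w generalizing N with
  | nil => exact .refl _
  | cons x w ih =>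
    simp only [List.length_cons] at hN
    cases x with
    | none =>
      rw [List.reduceOption_cons_of_none]
      refine Conn.trans ?_ (ih (by omega))
      have h1 := (conn_move_none (P := P) w le_rfl).append_right [none] (M := N) (by simp; omega)
      refine h1.trans ?_
      exact (conn_append_none (by simp) (by simp; omega)).symm
    | some x =>
      rw [List.reduceOption_cons_of_some]
      exact (ih le_rfl).append_left [some x] (by simp; omega)

/-- A cancellation x x⁻¹ = e leaves an identity character instead of the empty word. Keeping one e
at the end of every word makes room: the new e travels to the end and is absorbed, at the cost of
one unit of space. -/
theorem conn_map_some {w w' : List (α × Bool)} (h : Conn (freeRelations P) N w w') :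
    Conn (allRelations P) (N + 1) (w.map some ++ [none]) (w'.map some ++ [none]) := by
  have key : ∀ (u v : List (α × Bool)) (r) (_ : r ∈ freeRelations P),
      (u ++ r.1 ++ v).length ≤ N → (u ++ r.2 ++ v).length ≤ N →
      Conn (allRelations P) (N + 1) ((u ++ r.1 ++ v).map some ++ [none])
        ((u ++ r.2 ++ v).map some ++ [none]) := by
    rintro u v r (hr | ⟨x, rfl⟩) h1 h2
    · refine .of_step ⟨u.map some, v.map some ++ [none], _, .inl ⟨r, hr, rfl⟩, .inl (by simp)⟩ ?_ ?_
      · simp at h1 ⊢; omega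
      · simp at h2 ⊢; omega
    · simp only [List.length_append, List.length_cons, List.length_nil] at h1
      have h3 : Conn (allRelations P) (N + 1) (u.map some ++ [some x, some (x.1, !x.2)] ++
          (v.map some ++ [none])) (u.map some ++ [none] ++ (v.map some ++ [none])) :=
        .of_step ⟨u.map some, v.map some ++ [none], _, .inr (.inl ⟨x, rfl⟩), .inl ⟨rfl, rfl⟩⟩
          (by simp; omega) (by simp; omega)
      have h4 := (conn_move_none (P := P) (v.map some ++ [none]) le_rfl).append_left (u.map some)
        (M := N + 1) (by simp; omega)
      have h5 := (conn_append_none (P := P) (w := u.map some ++ v.map some ++ [none]) (N := N + 1)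
        (by simp) (by simp; omega)).symm
      simp only [List.map_append, List.append_assoc, List.map_cons, List.cons_append,
        List.nil_append] at h3 h4 h5 ⊢
      exact h3.trans (h4.trans h5)
  refine h.simulate (fun w => w.map some ++ [none]) fun w w' hs h1 h2 => ?_
  obtain ⟨u, v, r, hr, ⟨rfl, rfl⟩ | ⟨rfl, rfl⟩⟩ := hs
  · exact key u v r hr h1 h2
  · exact (key u v r hr h2 h1).symm

theorem conn_of_conn_nil {w w' : List (Letter α)} (hw : w ≠ []) (hw' : w' ≠ [])
    (h : Conn (freeRelations P) N w.reduceOption [])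
    (h' : Conn (freeRelations P) N w'.reduceOption [])
    (hM : N + w.length + w'.length + 1 ≤ M) :
    Conn (allRelations P) M w w' := by
  have key : ∀ w : List (Letter α), w ≠ [] → Conn (freeRelations P) N w.reduceOption [] →
      N + w.length + 1 ≤ M → Conn (allRelations P) M w [none] := fun w hw h hM =>
    ((conn_append_none hw (by omega)).trans (conn_reduceOption w (by omega))).trans
      ((conn_map_some h).mono (by omega))
  exact (key w hw h (by omega)).trans (key w' hw' h' (by omega)).symm

theorem eval_eq_value (w : List (Letter α)) :
    eval P w = value (fun x => (PresentedGroup.of x : PresGroup P)) w.reduceOption := by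
  induction w with
  | nil => simp [eval]
  | cons x w ih =>
    have h : eval P (x :: w) = letterValue P x * eval P w := by simp [eval]
    rw [h, ih]
    rcases x with _ | ⟨x, _ | _⟩
    · simp [letterValue]
    · rw [List.reduceOption_cons_of_some, value_cons]; simp [letterValue]
    · rw [List.reduceOption_cons_of_some, value_cons]; simp [letterValue]

/-- The universal property of the presented group. With it no isomorphism between that group and a
model is needed: triviality passes to the model, and a filling there uses the relations of the
presentation only. -/
theorem value_eq_one_of_eval_eq_one {G : Type} [Group G] (gen : α → G)
    (hP : ∀ r ∈ P, value gen r.1 = value gen r.2) {w : List (Letter α)} (h : eval P w = 1) :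
    value gen w.reduceOption = 1 := by
  have hrel : ∀ r ∈ relators P, FreeGroup.lift gen r = 1 := by
    rintro _ ⟨r, hr, rfl⟩
    rw [map_mul, map_inv, mul_inv_eq_one]
    exact hP r hr
  have h1 := congrArg (PresentedGroup.toGroup hrel) h
  rw [eval_eq_value, map_value, map_one] at h1
  simpa [Function.comp_def] using h1

theorem value_of_eq_of_mem {r : List (α × Bool) × List (α × Bool)} (hr : r ∈ P) :
    value (fun x => (PresentedGroup.of x : PresGroup P)) r.1 =
      value (fun x => (PresentedGroup.of x : PresGroup P)) r.2 := by
  have h : ∀ w, value (fun x => (PresentedGroup.of x : PresGroup P)) w =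
      PresentedGroup.mk (relators P) (FreeGroup.mk w) := fun w => by
    have : FreeGroup.lift (fun x => (PresentedGroup.of x : PresGroup P)) =
        PresentedGroup.mk (relators P) := by
      ext x; simp [PresentedGroup.of]
    rw [value, this]
  rw [h, h, ← mul_inv_eq_one, ← map_inv, ← map_mul]
  exact PresentedGroup.one_of_mem ⟨r, hr, rfl⟩

end Words

/-! ### The affine group of `ℤ[1/2]` -/

/-- The affine map `x ↦ 2 ^ exponent * x + shift` of `ℚ`. -/
@[ext] structure DyadicAffine where
  shift : ℚ
  exponent : ℤ

namespace DyadicAffine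

instance : Mul DyadicAffine :=
  ⟨fun f g => ⟨f.shift + 2 ^ f.exponent * g.shift, f.exponent + g.exponent⟩⟩

instance : One DyadicAffine := ⟨⟨0, 0⟩⟩

instance : Inv DyadicAffine := ⟨fun f => ⟨-(2 ^ (-f.exponent) * f.shift), -f.exponent⟩⟩

@[simp] theorem shift_mul (f g : DyadicAffine) :
    (f * g).shift = f.shift + 2 ^ f.exponent * g.shift := rfl

@[simp] theorem exponent_mul (f g : DyadicAffine) :
    (f * g).exponent = f.exponent + g.exponent := rfl

@[simp] theorem shift_one : (1 : DyadicAffine).shift = 0 := rfl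

@[simp] theorem exponent_one : (1 : DyadicAffine).exponent = 0 := rfl

@[simp] theorem shift_inv (f : DyadicAffine) :
    f⁻¹.shift = -(2 ^ (-f.exponent) * f.shift) := rfl

@[simp] theorem exponent_inv (f : DyadicAffine) : f⁻¹.exponent = -f.exponent := rfl

instance : Group DyadicAffine :=
  Group.ofLeftAxioms
    (fun f g h => by
      ext
      · simp [zpow_add₀, mul_add, add_assoc, mul_assoc]
      · simp [add_assoc])
    (fun f => by ext <;> simp)
    (fun f => by ext <;> simp)

/-- The translation `x ↦ x + 1`. -/
def translation : DyadicAffine := ⟨1, 0⟩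

/-- The contraction `x ↦ x / 2`. -/
def contraction : DyadicAffine := ⟨0, -1⟩

theorem translation_mul_contraction :
    translation * contraction = contraction * translation * translation := by
  ext
  · norm_num [translation, contraction]
  · simp [translation, contraction]

/-- Minus the exponent, as a homomorphism. -/
def height : DyadicAffine →* Multiplicative ℤ where
  toFun f := Multiplicative.ofAdd (-f.exponent)
  map_one' := by simp
  map_mul' f g := by
    rw [← ofAdd_add, exponent_mul, neg_add]

theorem translation_zpow (k : ℤ) : translation ^ k = ⟨k, 0⟩ := by
  have hn : ∀ j : ℕ, translation ^ j = ⟨j, 0⟩ := fun j => by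
    induction j with
    | zero => rw [pow_zero]; ext <;> simp
    | succ j ih => rw [pow_succ, ih]; ext <;> simp [translation]
  obtain ⟨j, rfl | rfl⟩ := k.eq_nat_or_neg
  · rw [zpow_natCast, hn]; simp
  · rw [zpow_neg, zpow_natCast, hn]; ext <;> simp

theorem contraction_zpow (k : ℤ) : contraction ^ k = ⟨0, -k⟩ := by
  have hn : ∀ j : ℕ, contraction ^ j = ⟨0, -j⟩ := fun j => by
    induction j with
    | zero => rw [pow_zero]; ext <;> simp
    | succ j ih => rw [pow_succ, ih]; ext <;> simp [contraction]; omega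
  obtain ⟨j, rfl | rfl⟩ := k.eq_nat_or_neg
  · rw [zpow_natCast, hn]
  · rw [zpow_neg, zpow_natCast, hn]; ext <;> simp

end DyadicAffine

/-! ### Models of the iterated Baumslag–Solitar groups -/

/-- A group with elements satisfying the relations of `iteratedBS (n + 1)`, with the exponent sum
of the last one well defined, and the first two generating a copy of the dyadic affine group. -/
structure BSModel (n : ℕ) where
  carrier : Type
  [group : Group carrier]
  gen : Fin (n + 2) → carrier
  rel : ∀ i : Fin (n + 1),
    gen i.castSucc * gen i.succ = gen i.succ * gen i.castSucc * gen i.castSucc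
  height : carrier →* Multiplicative ℤ
  height_last : height (gen (Fin.last _)) = Multiplicative.ofAdd 1
  height_castSucc : ∀ i : Fin (n + 1), height (gen i.castSucc) = 1
  emb : DyadicAffine →* carrier
  emb_injective : Function.Injective emb
  emb_translation : emb DyadicAffine.translation = gen 0
  emb_contraction : emb DyadicAffine.contraction = gen 1

attribute [instance] BSModel.group

theorem BSModel.value_rel {n : ℕ} (M : BSModel n) :
    ∀ r ∈ iteratedBS (n + 1), value M.gen r.1 = value M.gen r.2 := by
  rintro _ ⟨i, rfl⟩
  simp only [value_cons _ _ (_ :: _), value_singleton_true, M.rel i, mul_assoc]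

/-- The words representing `1` are filled in space `F`. -/
def BSModel.Fills {n : ℕ} (M : BSModel n) (F : ℕ → ℕ) : Prop :=
  ∀ w, value M.gen w = 1 → Conn (freeRelations (iteratedBS (n + 1))) (F w.length) w []

/-- The dyadic affine group as a model. -/
def affineModel : BSModel 0 where
  carrier := DyadicAffine
  gen := ![DyadicAffine.translation, DyadicAffine.contraction]
  rel i := by
    fin_cases i
    exact DyadicAffine.translation_mul_contraction
  height := DyadicAffine.height
  height_last := by
    simp [DyadicAffine.height, DyadicAffine.contraction, Fin.last]
  height_castSucc i := by
    fin_cases i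
    simp [DyadicAffine.height, DyadicAffine.translation]
  emb := MonoidHom.id _
  emb_injective := Function.injective_id
  emb_translation := rfl
  emb_contraction := rfl

/-! ### Filling words of the Baumslag–Solitar group in linear space -/

/-- A word for `a₀ ^ N` along which the powers of `a₁` rise by `k` at once and then fall. -/
def binaryRight : ℕ → ℤ → List (Fin 2 × Bool)
  | 0, N => power 0 N
  | k + 1, N => [(1, false)] ++ binaryRight k (N / 2) ++ [(1, true)] ++ power 0 (N % 2)

/-- A word for `a₀ ^ N` along which the powers of `a₁` rise by `k` and then fall at once. -/
def binaryLeft : ℕ → ℤ → List (Fin 2 × Bool)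
  | 0, N => power 0 N
  | k + 1, N => power 0 (N % 2) ++ [(1, false)] ++ binaryLeft k (N / 2) ++ [(1, true)]

theorem abs_ediv_two_le {N B : ℤ} (h : |N| ≤ B * 2) : |N / 2| ≤ B := by
  rw [abs_le] at h ⊢
  constructor <;> omega

theorem length_binaryRight_le {k K : ℕ} {N : ℤ} (h : |N| ≤ K * 2 ^ k) :
    (binaryRight k N).length ≤ 3 * k + K := by
  induction k generalizing N with
  | zero =>
    rw [pow_zero, mul_one, Int.abs_eq_natAbs] at h
    simp only [binaryRight, length_power]
    omega
  | succ k ih =>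
    have := ih (abs_ediv_two_le (by rwa [pow_succ, ← mul_assoc] at h))
    simp only [binaryRight, List.length_append, List.length_cons, List.length_nil, length_power]
    omega

theorem length_binaryLeft_le {k K : ℕ} {N : ℤ} (h : |N| ≤ K * 2 ^ k) :
    (binaryLeft k N).length ≤ 3 * k + K := by
  induction k generalizing N with
  | zero =>
    rw [pow_zero, mul_one, Int.abs_eq_natAbs] at h
    simp only [binaryLeft, length_power]
    omega
  | succ k ih =>
    have := ih (abs_ediv_two_le (by rwa [pow_succ, ← mul_assoc] at h))
    simp only [binaryLeft, List.length_append, List.length_cons, List.length_nil, length_power]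
    omega

/-- The relations of the group `BS(1, 2)`. -/
abbrev bsRel : Set (List (Fin 2 × Bool) × List (Fin 2 × Bool)) := freeRelations (iteratedBS 1)

theorem conn_bs : Conn bsRel 3 [(0, true), (1, true)] [(1, true), (0, true), (0, true)] :=
  Conn.of_rel (r := ([(0, true), (1, true)], [(1, true), (0, true), (0, true)]))
    (.inl ⟨0, rfl⟩) (by simp) (by simp)

/-- The defining relation conjugated by a₁, in the form that carries a digit to the right. -/
theorem conn_bs' : Conn bsRel 5 [(0, true), (0, true), (1, false)] [(1, false), (0, true)] := by
  have h1 := (conn_cancel_letter (P := iteratedBS 1) (1, false)).append_right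
    [(0, true), (0, true), (1, false)] (M := 5) (by simp)
  have h2 := conn_bs.context [(1, false)] [(1, false)] (M := 5) (by simp)
  have h3 := (conn_cancel_letter (P := iteratedBS 1) (1, true)).append_left
    [(1, false), (0, true)] (M := 5) (by simp)
  exact h1.symm.trans (h2.symm.trans h3)

/-- Binary increment: an even `N` only changes its last digit, while for odd `N` the relation turns
a₁ a₀ a₀ into a₀ a₁ and the carry is handled one level deeper. The innermost power of a₀ absorbs a
final carry. -/
theorem conn_binaryRight_succ {k K : ℕ} {N : ℤ} (h : |N| ≤ K * 2 ^ k)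
    (h' : |N + 1| ≤ K * 2 ^ k) :
    Conn bsRel (3 * k + K + 4) (binaryRight k N ++ [(0, true)]) (binaryRight k (N + 1)) := by
  induction k generalizing N with
  | zero =>
    rw [pow_zero, mul_one, Int.abs_eq_natAbs] at h
    have := conn_power_add (P := iteratedBS 1) (0 : Fin 2) N 1 (N := K + 4) (by omega)
    simpa [binaryRight] using this
  | succ k ih =>
    rw [pow_succ, ← mul_assoc] at h h'
    have hl := length_binaryRight_le (abs_ediv_two_le h)
    rcases Int.emod_two_eq_zero_or_one N with hN | hN
    · have h1 : (N + 1) / 2 = N / 2 := by omega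
      have h2 : (N + 1) % 2 = 1 := by omega
      simp only [binaryRight, hN, h1, h2, power_zero, power_one, List.append_nil]
      exact .refl _
    · have h1 : (N + 1) / 2 = N / 2 + 1 := by omega
      have h2 : (N + 1) % 2 = 0 := by omega
      have h3 := conn_bs.append_left ([(1, false)] ++ binaryRight k (N / 2))
        (M := 3 * (k + 1) + K + 4) (by simp; omega)
      have h4 := (ih (abs_ediv_two_le h) (by rw [← h1]; exact abs_ediv_two_le h')).context
        [(1, false)] [(1, true)] (M := 3 * (k + 1) + K + 4) (by simp; omega)
      simp only [binaryRight, hN, h1, h2, power_zero, power_one, List.append_nil]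
      simp only [List.append_assoc, List.cons_append, List.nil_append] at h3 h4 ⊢
      exact h3.symm.trans h4

theorem conn_binaryLeft_succ {k K : ℕ} {N : ℤ} (h : |N| ≤ K * 2 ^ k)
    (h' : |N + 1| ≤ K * 2 ^ k) :
    Conn bsRel (3 * k + K + 4) ([(0, true)] ++ binaryLeft k N) (binaryLeft k (N + 1)) := by
  induction k generalizing N with
  | zero =>
    rw [pow_zero, mul_one, Int.abs_eq_natAbs] at h
    have := conn_power_add (P := iteratedBS 1) (0 : Fin 2) 1 N (N := K + 4) (by omega)
    simpa [binaryLeft, add_comm] using this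
  | succ k ih =>
    rw [pow_succ, ← mul_assoc] at h h'
    have hl := length_binaryLeft_le (abs_ediv_two_le h)
    rcases Int.emod_two_eq_zero_or_one N with hN | hN
    · have h1 : (N + 1) / 2 = N / 2 := by omega
      have h2 : (N + 1) % 2 = 1 := by omega
      simp only [binaryLeft, hN, h1, h2, power_zero, power_one]
      exact .refl _
    · have h1 : (N + 1) / 2 = N / 2 + 1 := by omega
      have h2 : (N + 1) % 2 = 0 := by omega
      have h3 := conn_bs'.append_right (binaryLeft k (N / 2) ++ [(1, true)])
        (M := 3 * (k + 1) + K + 4) (by simp; omega)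
      have h4 := (ih (abs_ediv_two_le h) (by rw [← h1]; exact abs_ediv_two_le h')).context
        [(1, false)] [(1, true)] (M := 3 * (k + 1) + K + 4) (by simp; omega)
      simp only [binaryLeft, hN, h1, h2, power_zero, power_one]
      simp only [List.cons_append, List.nil_append] at h3 h4 ⊢
      exact h3.trans h4

theorem conn_binaryRight_zero (k : ℕ) : Conn bsRel (3 * k + 2) (binaryRight k 0) [] := by
  induction k with
  | zero => exact .refl _
  | succ k ih =>
    have h1 := ih.context [(1, false)] [(1, true)] (M := 3 * (k + 1) + 2) (by simp; omega)
    have h2 := (conn_cancel_letter (P := iteratedBS 1) (1, false)).mono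
      (M := 3 * (k + 1) + 2) (by omega)
    simpa [binaryRight] using h1.trans h2

theorem conn_binaryLeft_zero (k : ℕ) : Conn bsRel (3 * k + 2) (binaryLeft k 0) [] := by
  induction k with
  | zero => exact .refl _
  | succ k ih =>
    have h1 := ih.context [(1, false)] [(1, true)] (M := 3 * (k + 1) + 2) (by simp; omega)
    have h2 := (conn_cancel_letter (P := iteratedBS 1) (1, false)).mono
      (M := 3 * (k + 1) + 2) (by omega)
    simpa [binaryLeft] using h1.trans h2

theorem conn_binary_transfer {k K : ℕ} {N M : ℤ} (hN : |N| ≤ K * 2 ^ k)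
    (hN' : |N + 1| ≤ K * 2 ^ k) (hM : |M| ≤ K * 2 ^ k) (hM' : |M + 1| ≤ K * 2 ^ k) :
    Conn bsRel (6 * k + 2 * K + 4) (binaryRight k (N + 1) ++ binaryLeft k M)
      (binaryRight k N ++ binaryLeft k (M + 1)) := by
  have h1 := (conn_binaryRight_succ hN hN').append_right (binaryLeft k M)
    (M := 6 * k + 2 * K + 4) (by have := length_binaryLeft_le hM; omega)
  have h2 := (conn_binaryLeft_succ hM hM').append_left (binaryRight k N)
    (M := 6 * k + 2 * K + 4) (by have := length_binaryRight_le hN; omega)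
  rw [List.append_assoc] at h1
  exact h1.symm.trans h2

/-- Units are moved one at a time from the right factor to the left. That may take exponentially
many moves, but each is a carry on one side and a borrow on the other, so the space stays linear. -/
theorem conn_binary_add {k K : ℕ} {N M : ℤ} (h : |N| + |M| ≤ K * 2 ^ k) :
    Conn bsRel (6 * k + 2 * K + 4) (binaryRight k N ++ binaryLeft k M)
      (binaryRight k (N + M)) := by
  have hpos : ∀ (j : ℕ) (N M : ℤ), M.natAbs = j → |N| + |M| ≤ K * 2 ^ k →
      Conn bsRel (6 * k + 2 * K + 4) (binaryRight k N ++ binaryLeft k M)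
        (binaryRight k (N + M) ++ binaryLeft k 0) := by
    intro j
    induction j with
    | zero =>
      intro N M hj _
      obtain rfl : M = 0 := by omega
      simpa using Conn.refl _
    | succ j ih =>
      intro N M hj h
      simp only [Int.abs_eq_natAbs] at h
      rcases lt_or_gt_of_ne (show M ≠ 0 by omega) with hM | hM
      · have h1 := conn_binary_transfer (k := k) (K := K) (N := N - 1) (M := M)
          (by rw [Int.abs_eq_natAbs]; omega) (by rw [Int.abs_eq_natAbs]; omega)
          (by rw [Int.abs_eq_natAbs]; omega) (by rw [Int.abs_eq_natAbs]; omega)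
        have h2 := ih (N - 1) (M + 1) (by omega) (by simp only [Int.abs_eq_natAbs]; omega)
        rw [sub_add_cancel] at h1
        rw [show N - 1 + (M + 1) = N + M by ring] at h2
        exact h1.trans h2
      · have h1 := conn_binary_transfer (k := k) (K := K) (N := N) (M := M - 1)
          (by rw [Int.abs_eq_natAbs]; omega) (by rw [Int.abs_eq_natAbs]; omega)
          (by rw [Int.abs_eq_natAbs]; omega) (by rw [Int.abs_eq_natAbs]; omega)
        have h2 := ih (N + 1) (M - 1) (by omega) (by simp only [Int.abs_eq_natAbs]; omega)
        rw [sub_add_cancel] at h1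
        rw [show N + 1 + (M - 1) = N + M by ring] at h2
        exact h1.symm.trans h2
  refine (hpos _ N M rfl h).trans ?_
  have hl : (binaryRight k (N + M)).length ≤ 3 * k + K :=
    length_binaryRight_le ((abs_add_le N M).trans h)
  simpa using (conn_binaryLeft_zero k).append_left (binaryRight k (N + M))
    (M := 6 * k + 2 * K + 4) (by omega)

theorem power_neg_succ {α : Type} (x : α) (m : ℕ) :
    power x (-((m + 1 : ℕ) : ℤ)) = [(x, false)] ++ power x (-m) := by
  have := power_add_of_mul_nonneg x (j := -1) (k := -m) (by simp)
  rw [power_neg_one] at this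
  rw [← this]
  push_cast
  ring_nf

theorem power_succ {α : Type} (x : α) (m : ℕ) :
    power x ((m + 1 : ℕ) : ℤ) = power x m ++ [(x, true)] := by
  have := power_add_of_mul_nonneg x (j := m) (k := 1) (by simp)
  rw [power_one] at this
  rw [← this]
  push_cast
  ring_nf

theorem conn_binaryLeft_two_pow {k m : ℕ} (h : m ≤ k) :
    Conn bsRel (3 * k + 3) (binaryLeft k (2 ^ m)) (power 1 (-m) ++ [(0, true)] ++ power 1 m) := by
  induction m generalizing k with
  | zero =>
    cases k with
    | zero => simpa [binaryLeft] using Conn.refl _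
    | succ k =>
      have h1 := (conn_binaryLeft_zero k).context [(0, true), (1, false)] [(1, true)]
        (M := 3 * (k + 1) + 3) (by simp; omega)
      have h2 := (conn_cancel_letter (P := iteratedBS 1) (1, false)).append_left [(0, true)]
        (M := 3 * (k + 1) + 3) (by simp)
      simpa [binaryLeft] using h1.trans h2
  | succ m ih =>
    obtain ⟨k, rfl⟩ : ∃ j, k = j + 1 := ⟨k - 1, by omega⟩
    have h1 := (ih (k := k) (by omega)).context [(1, false)] [(1, true)] (M := 3 * (k + 1) + 3)
      (by simp; omega)
    have e1 : (2 : ℤ) ^ (m + 1) / 2 = 2 ^ m := by rw [pow_succ]; simp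
    have e2 : (2 : ℤ) ^ (m + 1) % 2 = 0 := by rw [pow_succ]; simp
    rw [power_neg_succ, power_succ]
    simp only [binaryLeft, e1, e2, power_zero]
    simpa using h1

/-- Inserting a₁^m a₁^(-m) after the letter a₀ exposes a₁^(-m) a₀ a₁^m = a₀^(2^m), which is then
added in binary. -/
theorem conn_binaryRight_mul_translation {k K m : ℕ} {N : ℤ} (hm : m ≤ k)
    (h : |N| + 2 ^ m ≤ K * 2 ^ k) :
    Conn bsRel (11 * k + 2 * K + 8) (binaryRight k N ++ power 1 (-m) ++ [(0, true)])
      (binaryRight k (N + 2 ^ m) ++ power 1 (-m)) := by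
  have hl : (binaryRight k N).length ≤ 3 * k + K :=
    length_binaryRight_le ((le_add_of_nonneg_right (by positivity)).trans h)
  have h1 := (conn_append_invRev (P := iteratedBS 1) (power (1 : Fin 2) m) (N := 2 * m)
    (by simp)).append_left (binaryRight k N ++ power 1 (-m) ++ [(0, true)])
    (M := 11 * k + 2 * K + 8) (by simp; omega)
  have h2 := (conn_binaryLeft_two_pow hm).context (binaryRight k N) (power 1 (-m))
    (M := 11 * k + 2 * K + 8) (by simp; omega)
  have h3 := (conn_binary_add (k := k) (K := K) (N := N) (M := 2 ^ m)
    (by rwa [abs_of_nonneg (by positivity : (0 : ℤ) ≤ 2 ^ m)])).append_right (power 1 (-m))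
    (M := 11 * k + 2 * K + 8) (by simp; omega)
  simp only [invRev_power, List.append_assoc, List.append_nil] at h1 h2 h3 ⊢
  exact h1.symm.trans (h2.symm.trans h3)

theorem conn_binaryRight_mul_translation_inv {k K m : ℕ} {N : ℤ} (hm : m ≤ k)
    (h : |N - 2 ^ m| + 2 ^ m ≤ K * 2 ^ k) :
    Conn bsRel (11 * k + 2 * K + 9) (binaryRight k N ++ power 1 (-m) ++ [(0, false)])
      (binaryRight k (N - 2 ^ m) ++ power 1 (-m)) := by
  have hl : (binaryRight k (N - 2 ^ m)).length ≤ 3 * k + K :=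
    length_binaryRight_le ((le_add_of_nonneg_right (by positivity)).trans h)
  have h1 := (conn_binaryRight_mul_translation hm h).append_right [(0, false)]
    (M := 11 * k + 2 * K + 9) (by simp)
  have h2 := (conn_cancel_letter (P := iteratedBS 1) (0, true)).append_left
    (binaryRight k (N - 2 ^ m) ++ power 1 (-m)) (M := 11 * k + 2 * K + 9) (by simp; omega)
  rw [sub_add_cancel] at h1
  simp only [List.append_assoc, List.cons_append, List.nil_append, List.append_nil,
    Bool.not_true] at h1 h2 ⊢
  exact h1.symm.trans h2

/-- A normal form for the elements represented by words of length at most `L`. -/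
def dyadicNormalForm (L : ℕ) (N : ℤ) (m : ℕ) : List (Fin 2 × Bool) :=
  power 1 L ++ (binaryRight (2 * L) N ++ power 1 (-m))

/-- The prefix a₁^L keeps the tail exponent -m nonpositive while at most `L` letters are read, so an
appended a₀^{±1} changes `N` by the integer 2^m. Since m ≤ 2L, 2L binary levels suffice. -/
theorem conn_dyadicNormalForm {L : ℕ} (w : List (Fin 2 × Bool)) (hw : w.length ≤ L) :
    ∃ (N : ℤ) (m : ℕ), |N| ≤ w.length * 2 ^ (2 * L) ∧ m ≤ L + w.length ∧ L ≤ m + w.length ∧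
      Conn bsRel (30 * L + 20 + w.length) w (dyadicNormalForm L N m) := by
  induction w using List.reverseRecOn with
  | nil =>
    refine ⟨0, L, by simp, by simp, by simp, Conn.symm ?_⟩
    have h1 := (conn_binaryRight_zero (2 * L)).context (power 1 L) (power 1 (-L))
      (M := 30 * L + 20 + 0) (by simp; omega)
    have h2 := conn_append_invRev (P := iteratedBS 1) (power (1 : Fin 2) L) (N := 30 * L + 20 + 0)
      (by simp; omega)
    simp only [List.append_assoc, invRev_power, List.append_nil] at h1 h2
    exact h1.trans h2
  | append_singleton w x ih =>
    simp only [List.length_append, List.length_cons, List.length_nil, zero_add] at hw ⊢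
    obtain ⟨N, m, hN, hm, hm', hc⟩ := ih (by omega)
    have hl : (binaryRight (2 * L) N).length ≤ 3 * (2 * L) + w.length :=
      length_binaryRight_le hN
    have hpow : (2 : ℤ) ^ m ≤ 2 ^ (2 * L) := pow_le_pow_right₀ (by norm_num) (by omega)
    have hpow0 : (0 : ℤ) < 2 ^ m := by positivity
    have hw1 : (w.length : ℤ) ≤ L - 1 := by omega
    have hN1 : |N| ≤ (L - 1) * 2 ^ (2 * L) := hN.trans (by gcongr)
    have hsub : |N - 2 ^ m| ≤ |N| + 2 ^ m := by
      simpa [abs_of_pos hpow0] using abs_sub N (2 ^ m)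
    have hadd : |N + 2 ^ m| ≤ |N| + 2 ^ m := by
      simpa [abs_of_pos hpow0] using abs_add_le N (2 ^ m)
    have hx := hc.append_right [x] (M := 30 * L + 20 + (w.length + 1)) (by simp)
    push_cast
    obtain ⟨i, b⟩ := x
    match i, b with
    | 0, true =>
      refine ⟨N + 2 ^ m, m, by linarith, by omega, by omega, hx.trans ?_⟩
      have h1 := (conn_binaryRight_mul_translation (k := 2 * L) (K := L + 1) (m := m) (N := N)
        (by omega) (by push_cast; linarith)).append_left (power 1 L)
        (M := 30 * L + 20 + (w.length + 1)) (by simp; omega)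
      simpa [dyadicNormalForm] using h1
    | 0, false =>
      refine ⟨N - 2 ^ m, m, by linarith, by omega, by omega, hx.trans ?_⟩
      -- `K = L + 1` because |N - 2^m| + 2^m ≤ |N| + 2 · 2^m with |N| ≤ (L - 1) 2^(2L).
      have h1 := (conn_binaryRight_mul_translation_inv (k := 2 * L) (K := L + 1) (m := m) (N := N)
        (by omega) (by push_cast; linarith)).append_left (power 1 L)
        (M := 30 * L + 20 + (w.length + 1)) (by simp; omega)
      simpa [dyadicNormalForm] using h1
    | 1, true =>
      -- Here m ≥ 1, since L ≤ m + |w| and |w| < L.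
      obtain ⟨m, rfl⟩ : ∃ j, m = j + 1 := ⟨m - 1, by omega⟩
      refine ⟨N, m, by linarith, by omega, by omega, hx.trans ?_⟩
      have h1 := (conn_power_add (P := iteratedBS 1) (1 : Fin 2) (-((m + 1 : ℕ) : ℤ)) 1
        le_rfl).append_left (power 1 L ++ binaryRight (2 * L) N)
        (M := 30 * L + 20 + (w.length + 1)) (by simp; omega)
      simpa [dyadicNormalForm] using h1
    | 1, false =>
      refine ⟨N, m + 1, by linarith, by omega, by omega, hx.trans ?_⟩
      have h1 := (conn_power_add (P := iteratedBS 1) (1 : Fin 2) (-m) (-1)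
        le_rfl).append_left (power 1 L ++ binaryRight (2 * L) N)
        (M := 30 * L + 20 + (w.length + 1)) (by simp; omega)
      rw [show (-m + -1 : ℤ) = -((m + 1 : ℕ) : ℤ) by push_cast; ring] at h1
      simpa [dyadicNormalForm] using h1

theorem value_binaryRight {G : Type} [Group G] (gen : Fin 2 → G)
    (h : gen 0 * gen 1 = gen 1 * gen 0 * gen 0) (k : ℕ) (N : ℤ) :
    value gen (binaryRight k N) = gen 0 ^ N := by
  induction k generalizing N with
  | zero => simp [binaryRight]
  | succ k ih =>
    have h1 : (gen 1)⁻¹ * gen 0 * gen 1 = gen 0 ^ (2 : ℤ) := by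
      rw [mul_assoc, h, zpow_two]; group
    have h2 : (gen 1)⁻¹ * gen 0 ^ (N / 2) * gen 1 = gen 0 ^ (2 * (N / 2)) := by
      have := conj_zpow (i := N / 2) (a := (gen 1)⁻¹) (b := gen 0)
      rw [inv_inv] at this
      rw [← this, h1, zpow_mul]
    simp only [binaryRight, value_append, value_singleton_false, value_singleton_true, ih,
      value_power, h2]
    rw [← zpow_add, Int.mul_ediv_add_emod]

/-- The normal form of a word with value 1 has exponent zero and shift zero, hence m = L and N = 0,
and it then collapses freely up to an empty binary expansion. -/
theorem affineModel_fills : affineModel.Fills fun L => 31 * L + 20 := by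
  intro w hw
  obtain ⟨N, m, hN, -, -, hc⟩ := conn_dyadicNormalForm (L := w.length) w le_rfl
  have h1 := value_eq_of_conn _ affineModel.value_rel hc
  rw [hw, dyadicNormalForm, value_append, value_append,
    value_binaryRight affineModel.gen (affineModel.rel 0), value_power, value_power] at h1
  replace h1 : (1 : DyadicAffine) = DyadicAffine.contraction ^ (w.length : ℤ) *
    (DyadicAffine.translation ^ N * DyadicAffine.contraction ^ (-m : ℤ)) := h1
  rw [DyadicAffine.contraction_zpow, DyadicAffine.contraction_zpow,
    DyadicAffine.translation_zpow] at h1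
  have h2 := congrArg DyadicAffine.exponent h1
  have h3 := congrArg DyadicAffine.shift h1
  simp at h2 h3
  obtain rfl : m = w.length := by omega
  subst h3
  refine (hc.mono (by dsimp only; omega)).trans ?_
  have h4 := (conn_binaryRight_zero (2 * w.length)).context (power 1 w.length)
    (power 1 (-w.length)) (M := 31 * w.length + 20) (by simp; omega)
  have h5 := conn_append_invRev (P := iteratedBS 1) (power (1 : Fin 2) w.length)
    (N := 31 * w.length + 20) (by simp; omega)
  simp only [List.append_assoc, invRev_power, List.append_nil] at h4 h5
  exact h4.trans h5

/-! ### The HNN extension doubling an element of infinite order -/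

section Doubling

variable {G : Type} [Group G] {a : G}

theorem zpowersHom_injective_of_height (χ : G →* Multiplicative ℤ)
    (ha : χ a = Multiplicative.ofAdd 1) {k : ℕ} (hk : k ≠ 0) :
    Function.Injective (zpowersHom G (a ^ k)) := by
  intro x y h
  have h1 := congrArg χ h
  simp only [zpowersHom_apply, map_zpow, map_pow, ha, ← ofAdd_nsmul, ← ofAdd_zsmul] at h1
  have h2 := Multiplicative.ofAdd.injective h1
  simpa [hk] using h2

/-- The isomorphism from `⟨a ^ 2⟩` to `⟨a⟩` sending `a ^ 2` to `a`. -/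
noncomputable def halving (h1 : Function.Injective (zpowersHom G (a ^ 2)))
    (h2 : Function.Injective (zpowersHom G (a ^ 1))) :
    (zpowersHom G (a ^ 2)).range ≃* (zpowersHom G (a ^ 1)).range :=
  (MonoidHom.ofInjective h1).symm.trans (MonoidHom.ofInjective h2)

theorem halving_apply (h1 : Function.Injective (zpowersHom G (a ^ 2)))
    (h2 : Function.Injective (zpowersHom G (a ^ 1))) (x : Multiplicative ℤ) :
    halving h1 h2 (MonoidHom.ofInjective h1 x) = MonoidHom.ofInjective h2 x := by
  simp [halving]

theorem halving_sq (h1 : Function.Injective (zpowersHom G (a ^ 2)))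
    (h2 : Function.Injective (zpowersHom G (a ^ 1))) :
    (HNNExtension.t : HNNExtension G _ _ (halving h1 h2)) * HNNExtension.of (a ^ 2) =
      HNNExtension.of a * HNNExtension.t := by
  have h := HNNExtension.t_mul_of (φ := halving h1 h2)
    (MonoidHom.ofInjective h1 (Multiplicative.ofAdd 1))
  rw [halving_apply] at h
  simpa [MonoidHom.ofInjective_apply] using h

end Doubling

/-! ### The next model as an HNN extension -/

namespace BSModel

variable {n : ℕ} (M : BSModel n)

/-- The last generator. -/
abbrev top : M.carrier := M.gen (Fin.last _)

theorem injective_sq : Function.Injective (zpowersHom M.carrier (M.top ^ 2)) :=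
  zpowersHom_injective_of_height M.height M.height_last two_ne_zero

theorem injective_one : Function.Injective (zpowersHom M.carrier (M.top ^ 1)) :=
  zpowersHom_injective_of_height M.height M.height_last one_ne_zero

/-- The HNN extension of a model with a stable letter doubling the last generator. -/
abbrev Extension : Type :=
  HNNExtension M.carrier _ _ (halving M.injective_sq M.injective_one)

/-- The generators of the extension. -/
noncomputable def extensionGen : Fin (n + 3) → M.Extension :=
  Fin.snoc (α := fun _ => M.Extension) (fun i => HNNExtension.of (M.gen i)) HNNExtension.t

@[simp] theorem extensionGen_castSucc (i : Fin (n + 2)) :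
    M.extensionGen i.castSucc = HNNExtension.of (M.gen i) := by simp [extensionGen]

@[simp] theorem extensionGen_last :
    M.extensionGen (Fin.last _) = HNNExtension.t := by simp [extensionGen]

/-- The next model. -/
noncomputable def succ (M : BSModel n) : BSModel (n + 1) where
  carrier := M.Extension
  gen := M.extensionGen
  rel i := by
    induction i using Fin.lastCases with
    | last =>
      rw [Fin.succ_last, extensionGen_last, extensionGen_castSucc, mul_assoc, ← map_mul, ← pow_two]
      exact (halving_sq M.injective_sq M.injective_one).symm
    | cast i =>
      rw [Fin.succ_castSucc, extensionGen_castSucc, extensionGen_castSucc, ← map_mul, M.rel i,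
        map_mul, map_mul]
  height := HNNExtension.lift 1 (Multiplicative.ofAdd 1) (by simp)
  height_last := by simp
  height_castSucc i := by simp
  emb := HNNExtension.of.comp M.emb
  emb_injective := by
    rw [MonoidHom.coe_comp]
    exact (HNNExtension.of_injective _).comp M.emb_injective
  emb_translation := by
    rw [MonoidHom.comp_apply, M.emb_translation]
    exact (M.extensionGen_castSucc 0).symm
  emb_contraction := by
    rw [MonoidHom.comp_apply, M.emb_contraction]
    exact (M.extensionGen_castSucc 1).symm

theorem value_rename_castSucc (v : List (Fin (n + 2) × Bool)) :
    value M.extensionGen (rename Fin.castSucc v) = HNNExtension.of (value M.gen v) := by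
  rw [value_rename, map_value]
  congr 1
  funext i
  simp

/-- The last generator is undistorted: a word representing its k-th power has at least |k| letters.
This keeps the exponents in pinches linear. -/
theorem natAbs_height_value_le (w : List (Fin (n + 2) × Bool)) :
    (Multiplicative.toAdd (M.height (value M.gen w))).natAbs ≤ w.length := by
  have key : ∀ i, (Multiplicative.toAdd (M.height (M.gen i))).natAbs ≤ 1 := fun i => by
    induction i using Fin.lastCases with
    | last => simp [M.height_last]
    | cast i => simp [M.height_castSucc]
  induction w with
  | nil => simp
  | cons x w ih =>
    rw [value_cons, map_mul, toAdd_mul, List.length_cons]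
    have h1 := key x.1
    obtain ⟨i, _ | _⟩ := x
    · simp only [value_singleton_false, map_inv, toAdd_inv] at h1 ⊢
      omega
    · simp only [value_singleton_true] at h1 ⊢
      omega

end BSModel

/-! ### Decomposing words along the last letter -/

/-- The word `v₀ t^{±1} v₁ t^{±1} ⋯ v_k` with `t` the last letter. -/
def assemble {n : ℕ} (v : List (Fin n × Bool)) (ts : List (Bool × List (Fin n × Bool))) :
    List (Fin (n + 1) × Bool) :=
  rename Fin.castSucc v ++ ts.flatMap fun p => (Fin.last n, p.1) :: rename Fin.castSucc p.2

theorem exists_assemble {n : ℕ} (w : List (Fin (n + 1) × Bool)) :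
    ∃ v ts, w = assemble v ts := by
  induction w with
  | nil => exact ⟨[], [], by simp [assemble, rename]⟩
  | cons x w ih =>
    obtain ⟨v, ts, rfl⟩ := ih
    obtain ⟨i, b⟩ := x
    induction i using Fin.lastCases with
    | last => exact ⟨[], (b, v) :: ts, by simp [assemble, rename]⟩
    | cast i => exact ⟨(i, b) :: v, ts, by simp [assemble, rename]⟩

/-- The sign of a letter. -/
def letterSign (b : Bool) : ℤˣ := if b then 1 else -1

/-- Britton's lemma. If the decomposition along t is reduced, a value in the base group forces it to
contain no t; otherwise some consecutive pair violates the reducedness condition, which is exactly a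
pinch. -/
theorem BSModel.exists_pinch {n : ℕ} (M : BSModel n) {w : List (Fin (n + 3) × Bool)}
    (hw : value M.extensionGen w = 1) :
    (∃ v, w = rename Fin.castSucc v) ∨
    ∃ (X Y : List (Fin (n + 3) × Bool)) (V : List (Fin (n + 2) × Bool)) (b : Bool) (k : ℤ),
      w = X ++ ([(Fin.last _, b)] ++ rename Fin.castSucc V ++ [(Fin.last _, !b)]) ++ Y ∧
      value M.gen V = M.top ^ (if b then 2 * k else k) := by
  obtain ⟨v, ts, rfl⟩ := exists_assemble w
  let R : Bool × List (Fin (n + 2) × Bool) → Bool × List (Fin (n + 2) × Bool) → Prop := fun p q =>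
    value M.gen p.2 ∈ HNNExtension.toSubgroup (zpowersHom M.carrier (M.top ^ 2)).range
      (zpowersHom M.carrier (M.top ^ 1)).range (letterSign p.1) → letterSign p.1 = letterSign q.1
  by_cases hchain : ts.IsChain R
  · left
    let r : HNNExtension.NormalWord.ReducedWord M.carrier
        (zpowersHom M.carrier (M.top ^ 2)).range (zpowersHom M.carrier (M.top ^ 1)).range :=
      ⟨value M.gen v, ts.map fun p => (letterSign p.1, value M.gen p.2),
        (List.isChain_map _).2 hchain⟩
    have hprod : r.prod (halving M.injective_sq M.injective_one) =
        value M.extensionGen (assemble v ts) := by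
      have h1 : ∀ ts : List (Bool × List (Fin (n + 2) × Bool)),
          value M.extensionGen
            (ts.flatMap fun p => (Fin.last _, p.1) :: rename Fin.castSucc p.2) =
          ((ts.map fun p => (letterSign p.1, value M.gen p.2)).map fun x =>
            (HNNExtension.t : M.Extension) ^ (x.1 : ℤ) * HNNExtension.of x.2).prod := fun ts => by
        induction ts with
        | nil => simp
        | cons p ts ih =>
          rw [List.flatMap_cons, value_append, ih, value_cons, M.value_rename_castSucc]
          obtain ⟨_ | _, p⟩ := p <;> simp [letterSign]
      rw [assemble, value_append, M.value_rename_castSucc, h1]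
      rfl
    have hnil := HNNExtension.ReducedWord.toList_eq_nil_of_mem_of_range
      (halving M.injective_sq M.injective_one) r (by rw [hprod, hw]; exact one_mem _)
    obtain rfl : ts = [] := by simpa [r] using hnil
    exact ⟨v, by simp [assemble]⟩
  · right
    rw [List.isChain_iff_forall_rel_of_append_cons_cons] at hchain
    push Not at hchain
    obtain ⟨p, q, l1, l2, rfl, hR⟩ := hchain
    simp only [R, Classical.not_imp] at hR
    obtain ⟨hmem, hne⟩ := hR
    obtain ⟨b, V⟩ := p
    obtain ⟨b', V'⟩ := q
    obtain rfl : b' = !b := by cases b <;> cases b' <;> simp_all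
    have hk : ∃ k : ℤ, value M.gen V = M.top ^ (if b then 2 * k else k) := by
      cases b
      · obtain ⟨k, hk⟩ := hmem
        exact ⟨Multiplicative.toAdd k, by rw [← hk]; simp⟩
      · obtain ⟨k, hk⟩ := hmem
        exact ⟨Multiplicative.toAdd k, by rw [← hk]; simp [zpow_mul]⟩
    obtain ⟨k, hk⟩ := hk
    exact ⟨assemble v l1, assemble V' l2, V, b, k, by simp [assemble], hk⟩

/-! ### Filling words of the extension -/

section Pinch

variable {α : Type} {P : Set (List (α × Bool) × List (α × Bool))} {a t : α}

/-- For k ≥ 0 the letters a pass t one by one, each doubling. -/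
theorem conn_power_mul (hr : ([(a, true), (t, true)], [(t, true), (a, true), (a, true)]) ∈ P)
    (k : ℤ) : Conn (freeRelations P) (6 * k.natAbs + 4)
      (power a k ++ [(t, true)]) ([(t, true)] ++ power a (2 * k)) := by
  have hpos : ∀ k : ℕ, Conn (freeRelations P) (2 * k + 4)
      (power a k ++ [(t, true)]) ([(t, true)] ++ power a (2 * k)) := fun k => by
    induction k with
    | zero => simpa using Conn.refl _
    | succ k ih =>
      have h1 := (Conn.of_rel (R := freeRelations P) (N := 3) (.inl hr) (by simp)
        (by simp)).append_left (power a k) (M := 2 * (k + 1) + 4) (by simp; omega)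
      have h2 := ih.append_right [(a, true), (a, true)] (M := 2 * (k + 1) + 4) (by simp; omega)
      have e : (2 * ((k + 1 : ℕ) : ℤ)) = ((2 * k + 1 + 1 : ℕ) : ℤ) := by push_cast; ring
      have e' : (2 * (k : ℤ)) = ((2 * k : ℕ) : ℤ) := by push_cast; ring
      rw [e, power_succ, power_succ, power_succ]
      rw [e'] at h2
      simp only [List.append_assoc, List.cons_append, List.nil_append] at h1 h2 ⊢
      exact h1.trans h2
  obtain ⟨j, rfl | rfl⟩ := k.eq_nat_or_neg
  · exact (hpos j).mono (by simp; omega)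
  -- For k = -j, insert a^(2j) a^(-2j) at the end, use the positive case backwards to turn t a^(2j)
  -- into a^j t, and cancel a^(-j) a^j.
  · have h1 := (conn_append_invRev (P := P) (power a (2 * j)) (N := 4 * j)
      (by simp; omega)).append_left (power a (-j) ++ [(t, true)])
      (M := 6 * j + 4) (by simp; omega)
    have h2 := (hpos j).context (power a (-j)) (power a (-(2 * j)))
      (M := 6 * j + 4) (by simp; omega)
    have h3 := (conn_invRev_append (P := P) (power a j) (N := 2 * j)
      (by simp)).append_right ([(t, true)] ++ power a (-(2 * j)))
      (M := 6 * j + 4) (by simp; omega)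
    rw [mul_neg, Int.natAbs_neg, Int.natAbs_natCast]
    simp only [invRev_power, List.append_assoc, List.append_nil, List.nil_append] at h1 h2 h3 ⊢
    exact h1.symm.trans (h2.symm.trans h3)

theorem conn_pinch (hr : ([(a, true), (t, true)], [(t, true), (a, true), (a, true)]) ∈ P)
    (b : Bool) (k : ℤ) : Conn (freeRelations P) (6 * k.natAbs + 5)
      ([(t, b)] ++ power a (if b then 2 * k else k) ++ [(t, !b)])
      (power a (if b then k else 2 * k)) := by
  cases b
  · have h1 := (conn_power_mul hr k).append_left [(t, false)] (M := 6 * k.natAbs + 5) (by simp; omega)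
    have h2 := (conn_cancel_letter (P := P) (t, false)).append_right (power a (2 * k))
      (M := 6 * k.natAbs + 5) (by simp; omega)
    simpa using h1.trans h2
  · have h1 := (conn_power_mul hr k).append_right [(t, false)] (M := 6 * k.natAbs + 5) (by simp)
    have h2 := (conn_cancel_letter (P := P) (t, true)).append_left (power a k)
      (M := 6 * k.natAbs + 5) (by simp; omega)
    simp only [List.append_assoc] at h1
    simpa using h1.symm.trans h2

end Pinch

/-! ### From fillings of a model to fillings of the next -/

theorem rename_castSucc_rel (n : ℕ) : ∀ r ∈ iteratedBS n,
    (rename Fin.castSucc r.1, rename Fin.castSucc r.2) ∈ iteratedBS (n + 1) := by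
  rintro _ ⟨i, rfl⟩
  exact ⟨i.castSucc, by simp [rename]⟩

/-- The number of occurrences of the last generator and its inverse. -/
def lastCount {n : ℕ} (w : List (Fin (n + 1) × Bool)) : ℕ :=
  w.countP fun x => decide (x.1 = Fin.last n)

theorem lastCount_append {n : ℕ} (w w' : List (Fin (n + 1) × Bool)) :
    lastCount (w ++ w') = lastCount w + lastCount w' := by simp [lastCount]

theorem lastCount_rename {n : ℕ} (v : List (Fin n × Bool)) :
    lastCount (rename Fin.castSucc v) = 0 := by
  simp [lastCount, rename]

namespace BSModel

variable {n : ℕ} {M : BSModel n} {F : ℕ → ℕ}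

/-- The word V a^(-k) is trivial of length at most 2|V|, so it can be filled after a^(-k) a^k has
been inserted behind V. -/
theorem Fills.conn_power (hF : M.Fills F) (hmono : Monotone F)
    {V : List (Fin (n + 2) × Bool)} {k : ℤ} (hV : value M.gen V = M.top ^ k) :
    k.natAbs ≤ V.length ∧
      Conn (freeRelations (iteratedBS (n + 1))) (F (2 * V.length) + 3 * V.length) V
        (power (Fin.last _) k) := by
  have hk : k.natAbs ≤ V.length := by
    simpa [hV, M.height_last] using M.natAbs_height_value_le V
  refine ⟨hk, ?_⟩
  have h1 := hF (V ++ power (Fin.last _) (-k)) (by simp [hV])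
  have hlen : (V ++ power (Fin.last _) (-k)).length ≤ 2 * V.length := by simp; omega
  have h2 := (h1.mono (hmono hlen)).append_right (power (Fin.last _) k)
    (M := F (2 * V.length) + 3 * V.length) (by simp; omega)
  have h3 := (conn_invRev_append (P := iteratedBS (n + 1)) (power (Fin.last (n + 1)) k)
    (N := 2 * k.natAbs) (by simp)).append_left V
    (M := F (2 * V.length) + 3 * V.length) (by omega)
  simp only [invRev_power, List.append_assoc, List.append_nil, List.nil_append] at h2 h3
  exact h3.symm.trans h2

theorem Fills.exists_reduction (hF : M.Fills F) (hmono : Monotone F)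
    {w : List (Fin (n + 3) × Bool)} (hw : value M.extensionGen w = 1) :
    (∃ v, w = rename Fin.castSucc v) ∨
    ∃ w', Conn (freeRelations (iteratedBS (n + 2))) (F (2 * w.length) + 7 * w.length + 5) w w' ∧
      w'.length ≤ 2 * w.length ∧ lastCount w' < lastCount w := by
  refine (M.exists_pinch hw).imp_right ?_
  rintro ⟨X, Y, V, b, k, rfl, hV⟩
  obtain ⟨hk, hc⟩ := hF.conn_power hmono hV
  have hk1 : k.natAbs ≤ V.length := by split at hk <;> omega
  have hk2 : (if b then k else 2 * k).natAbs ≤ 2 * V.length := by split at hk <;> simp [*] <;> omega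
  refine ⟨X ++ power (Fin.last _).castSucc (if b then k else 2 * k) ++ Y, ?_, ?_, ?_⟩
  · generalize hL : (X ++ ([(Fin.last (n + 2), b)] ++ rename Fin.castSucc V ++
      [(Fin.last _, !b)]) ++ Y).length = L
    have hL' : X.length + V.length + Y.length + 2 = L := by rw [← hL]; simp; omega
    have hFm : F (2 * V.length) ≤ F (2 * L) := hmono (by omega)
    have h1 := (hc.rename Fin.castSucc (rename_castSucc_rel (n + 1))).context
      (X ++ [(Fin.last (n + 2), b)]) ([(Fin.last _, !b)] ++ Y)
      (M := F (2 * L) + 7 * L + 5) (by simp; omega)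
    have h2 := (conn_pinch (P := iteratedBS (n + 2)) (a := (Fin.last (n + 1)).castSucc)
      (t := Fin.last _) ⟨Fin.last _, by simp⟩ b k).context X Y
      (M := F (2 * L) + 7 * L + 5) (by omega)
    simp only [rename_power, List.append_assoc] at h1 h2 ⊢
    exact h1.trans h2
  · simp only [List.length_append, length_power, List.length_cons, List.length_nil,
      length_rename]
    omega
  · simp only [lastCount_append, lastCount_rename]
    have h1 : lastCount (power (Fin.last (n + 1)).castSucc (if b then k else 2 * k)) = 0 := by
      rw [← rename_power, lastCount_rename]
    have h2 : ∀ b, lastCount [(Fin.last (n + 2), b)] = 1 := fun b => by simp [lastCount]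
    rw [h1, h2, h2]
    omega

/-- Induction on the number of letters t^{±1}: each pinch removes two of them and at most doubles
the length. Once none is left, the word is trivial in the base model, since that embeds in the
extension. -/
theorem Fills.succ (hF : M.Fills F) (hmono : Monotone F) :
    M.succ.Fills fun L => F (2 ^ (L + 1) * L) + 7 * 2 ^ L * L + 5 := by
  have key : ∀ (p : ℕ) (w : List (Fin (n + 3) × Bool)), lastCount w ≤ p →
      value M.extensionGen w = 1 → Conn (freeRelations (iteratedBS (n + 2)))
        (F (2 ^ (p + 1) * w.length) + 7 * 2 ^ p * w.length + 5) w [] := by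
    have base : ∀ (p : ℕ) (v : List (Fin (n + 2) × Bool)),
        value M.extensionGen (rename Fin.castSucc v) = 1 →
        Conn (freeRelations (iteratedBS (n + 2)))
          (F (2 ^ (p + 1) * v.length) + 7 * 2 ^ p * v.length + 5) (rename Fin.castSucc v) [] := by
      intro p v hv
      rw [M.value_rename_castSucc, ← map_one HNNExtension.of] at hv
      have h1 := (hF v (HNNExtension.of_injective _ hv)).rename Fin.castSucc
        (rename_castSucc_rel (n + 1))
      have h2 : F v.length ≤ F (2 ^ (p + 1) * v.length) :=
        hmono (Nat.le_mul_of_pos_left _ (by positivity))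
      exact h1.mono (by omega)
    intro p
    induction p with
    | zero =>
      intro w hp hw
      rcases hF.exists_reduction hmono hw with ⟨v, rfl⟩ | ⟨w', -, -, h⟩
      · simpa using base 0 v hw
      · omega
    | succ p ih =>
      intro w hp hw
      rcases hF.exists_reduction hmono hw with ⟨v, rfl⟩ | ⟨w', hc, hl, h⟩
      · simpa using base (p + 1) v hw
      · have h1 := ih w' (by omega)
          ((value_eq_of_conn M.extensionGen M.succ.value_rel hc).symm.trans hw)
        have hp1 : 1 ≤ 2 ^ p := Nat.one_le_two_pow
        have e1 : F (2 * w.length) ≤ F (2 ^ (p + 1 + 1) * w.length) := by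
          refine hmono (Nat.mul_le_mul_right _ ?_)
          rw [pow_succ, pow_succ]; omega
        have e2 : F (2 ^ (p + 1) * w'.length) ≤ F (2 ^ (p + 1 + 1) * w.length) := by
          refine hmono ((Nat.mul_le_mul_left _ hl).trans (le_of_eq ?_))
          ring
        have e3 : 7 * 2 ^ p * w'.length ≤ 7 * 2 ^ (p + 1) * w.length :=
          (Nat.mul_le_mul_left _ hl).trans (le_of_eq (by ring))
        have e4 : 7 * w.length ≤ 7 * 2 ^ (p + 1) * w.length :=
          Nat.mul_le_mul_right _ (by rw [pow_succ]; omega)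
        exact (hc.mono (by omega)).trans (h1.mono (by omega))
  intro w hw
  exact key w.length w List.countP_le_length hw

end BSModel

/-! ### The flux of a word -/

/-- The exponential tower `2 ^ 2 ^ ⋯ ^ x` of height `k`. -/
def tower (k x : ℕ) : ℕ := (fun y => 2 ^ y)^[k] x

@[simp] theorem tower_zero (x : ℕ) : tower 0 x = x := rfl

theorem tower_succ (k x : ℕ) : tower (k + 1) x = 2 ^ tower k x :=
  Function.iterate_succ_apply' _ _ _

section Flux

variable {n : ℕ} {G : Type} [Group G] (gen : Fin (n + 2) → G) (ψ : G → ℤ)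

/-- The total weight of the edges labelled by the first generator on the path that starts at `g`
and spells `w`, the edge from `h` having weight `ψ h`. -/
def flux (g : G) : List (Fin (n + 2) × Bool) → ℤ
  | [] => 0
  | x :: w =>
    (if x.1 = 0 then cond x.2 (ψ g) (-ψ (g * (gen 0)⁻¹)) else 0) + flux (g * value gen [x]) w

theorem flux_append (g : G) (u v : List (Fin (n + 2) × Bool)) :
    flux gen ψ g (u ++ v) = flux gen ψ g u + flux gen ψ (g * value gen u) v := by
  induction u generalizing g with
  | nil => simp [flux]
  | cons x u ih =>
    rw [List.cons_append, flux, ih, flux, value_cons gen x u, mul_assoc, add_assoc]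

theorem flux_eq_zero (g : G) {w : List (Fin (n + 2) × Bool)} (hw : ∀ x ∈ w, x.1 ≠ 0) :
    flux gen ψ g w = 0 := by
  induction w generalizing g with
  | nil => rfl
  | cons x w ih =>
    rw [flux, if_neg (hw x (by simp)), ih _ fun y hy => hw y (by simp [hy]), add_zero]

variable {gen ψ}

/-- Both sides of a relation have the same endpoint, so only the part of the path along the relation
matters. Free cancellations traverse an edge back and forth, the relations with i > 1 contain no a₀,
and the relation between a₀ and a₁ is the hypothesis on `ψ`. -/
theorem abs_flux_sub_le_of_step
    (hgen : ∀ r ∈ iteratedBS (n + 1), value gen r.1 = value gen r.2)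
    (hψ : ∀ g, |ψ g - (ψ (g * gen 1) + ψ (g * gen 1 * gen 0))| ≤ 1)
    {w w' : List (Letter (Fin (n + 2)))} (h : Step (allRelations (iteratedBS (n + 1))) w w') :
    |flux gen ψ 1 w.reduceOption - flux gen ψ 1 w'.reduceOption| ≤ 1 := by
  have key : ∀ r ∈ allRelations (iteratedBS (n + 1)),
      value gen r.1.reduceOption = value gen r.2.reduceOption ∧
      ∀ g, |flux gen ψ g r.1.reduceOption - flux gen ψ g r.2.reduceOption| ≤ 1 := by
    rintro r (⟨r, hr, rfl⟩ | ⟨⟨i, b⟩, rfl⟩ | ⟨x, rfl⟩ | ⟨x, rfl⟩ | ⟨x, rfl⟩)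
    · have hid : ∀ l : List (Fin (n + 2) × Bool), (l.map some).reduceOption = l := fun l => by
        simp [List.reduceOption]
      simp only [hid]
      refine ⟨hgen r hr, fun g => ?_⟩
      obtain ⟨i, rfl⟩ := hr
      rcases eq_or_ne i 0 with rfl | hi
      · simpa [flux] using hψ g
      · have h1 : i.castSucc ≠ 0 := by simpa using hi
        simp [flux, h1, Fin.succ_ne_zero]
    · rcases eq_or_ne i 0 with rfl | hi
      · cases b
        · simp [List.reduceOption, flux, value_cons gen _ [_]]
        · simp [List.reduceOption, flux, value_cons gen _ [_]]
      · cases b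
        · simp [List.reduceOption, flux, hi, value_cons gen _ [_]]
        · simp [List.reduceOption, flux, hi, value_cons gen _ [_]]
    · cases x <;> simp [List.reduceOption]
    · cases x <;> simp [List.reduceOption]
    · cases x <;> simp [List.reduceOption]
  have key' : ∀ (u v) (r), r ∈ allRelations (iteratedBS (n + 1)) →
      |flux gen ψ 1 (u ++ r.1 ++ v).reduceOption - flux gen ψ 1 (u ++ r.2 ++ v).reduceOption| ≤ 1 := by
    intro u v r hr
    obtain ⟨h1, h2⟩ := key r hr
    simp only [List.reduceOption_append, flux_append, value_append, h1]
    convert h2 (1 * value gen u.reduceOption) using 2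
    ring
  obtain ⟨u, v, r, hr, ⟨rfl, rfl⟩ | ⟨rfl, rfl⟩⟩ := h
  · exact key' u v r hr
  · rw [abs_sub_comm]; exact key' u v r hr

theorem natAbs_flux_sub_le_dehn
    (hgen : ∀ r ∈ iteratedBS (n + 1), value gen r.1 = value gen r.2)
    (hψ : ∀ g, |ψ g - (ψ (g * gen 1) + ψ (g * gen 1 * gen 0))| ≤ 1)
    (w w' : List (Letter (Fin (n + 2)))) :
    ((flux gen ψ 1 w.reduceOption - flux gen ψ 1 w'.reduceOption).natAbs : ℕ∞) ≤
      dehn (allRelations (iteratedBS (n + 1))) w w' := by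
  refine le_iInf fun D => ?_
  norm_cast
  induction D with
  | nil w => simp
  | cons w h D ih =>
    have := abs_flux_sub_le_of_step hgen hψ h
    rw [Int.abs_eq_natAbs] at this
    simp only [Derivation.steps]
    omega

end Flux

/-! ### The weight function -/

open Classical in
/-- The weight of an edge of the Cayley graph of the dyadic affine group. -/
noncomputable def edgeWeight (x : DyadicAffine) : ℤ :=
  if 1 ≤ x.exponent ∧ ∃ k : ℤ, x.shift = 2 * k then 2 ^ (x.exponent - 1).toNat else 0

-- At exponent h ≥ 2 the weight splits evenly over two edges at exponent h - 1: these start at b and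
-- b + 2^(h-1), which are even integers exactly when b is. A defect of one occurs only at h = 1, so
-- the flux counts cells at that level with sign. The parity condition singles out one of two
-- sheets.
open Classical in
theorem abs_edgeWeight_sub_le (x : DyadicAffine) :
    |edgeWeight x - (edgeWeight (x * DyadicAffine.contraction) +
      edgeWeight (x * DyadicAffine.contraction * DyadicAffine.translation))| ≤ 1 := by
  obtain ⟨b, h⟩ := x
  have p1 : DyadicAffine.mk b h * DyadicAffine.contraction = ⟨b, h - 1⟩ := by
    ext <;> simp [DyadicAffine.contraction, sub_eq_add_neg]
  have p2 : DyadicAffine.mk b h * DyadicAffine.contraction * DyadicAffine.translation =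
      ⟨b + 2 ^ (h - 1), h - 1⟩ := by
    rw [p1]; ext <;> simp [DyadicAffine.translation]
  rw [p2, p1]
  simp only [edgeWeight]
  rcases le_or_gt h 1 with hh | hh
  · have h1 : ¬1 ≤ h - 1 := by omega
    have h2 : (h - 1).toNat = 0 := by omega
    simp only [h1, false_and, if_false, h2, pow_zero]
    split <;> simp
  · obtain ⟨j, rfl⟩ : ∃ j : ℕ, h = j + 2 := ⟨(h - 2).toNat, by omega⟩
    have e1 : ((j : ℤ) + 2 - 1).toNat = j + 1 := by omega
    have e2 : ((j : ℤ) + 2 - 1 - 1).toNat = j := by omega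
    have e3 : (2 : ℚ) ^ ((j : ℤ) + 2 - 1) = 2 * 2 ^ j := by
      rw [show (j : ℤ) + 2 - 1 = ((j + 1 : ℕ) : ℤ) by push_cast; ring, zpow_natCast, pow_succ]
      ring
    have e4 : (∃ k : ℤ, b + 2 * 2 ^ j = 2 * k) ↔ ∃ k : ℤ, b = 2 * k := by
      constructor
      · rintro ⟨k, hk⟩
        exact ⟨k - 2 ^ j, by push_cast; linarith⟩
      · rintro ⟨k, hk⟩
        exact ⟨k + 2 ^ j, by push_cast; linarith⟩
    simp only [e1, e2, e3, e4, show 1 ≤ (j : ℤ) + 2 by omega, show 1 ≤ (j : ℤ) + 2 - 1 by omega,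
      true_and]
    split
    · rw [pow_succ]; simp [mul_two]
    · simp

namespace BSModel

variable {n : ℕ} (M : BSModel n)

/-- The weight of an edge of the Cayley graph of a model. -/
noncomputable def weight : M.carrier → ℤ := Function.extend M.emb edgeWeight 0

@[simp] theorem weight_emb (x : DyadicAffine) : M.weight (M.emb x) = edgeWeight x :=
  M.emb_injective.extend_apply _ _ _

/-- The weight is zero off the embedded affine group. Right multiplication by a₀ and a₁ preserves
that subgroup and its complement, so each relation lies entirely in one of them. -/
theorem abs_weight_sub_le (g : M.carrier) :
    |M.weight g - (M.weight (g * M.gen 1) + M.weight (g * M.gen 1 * M.gen 0))| ≤ 1 := by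
  rw [← M.emb_contraction, ← M.emb_translation]
  by_cases hg : ∃ x, M.emb x = g
  · obtain ⟨x, rfl⟩ := hg
    rw [← map_mul, ← map_mul, weight_emb, weight_emb, weight_emb]
    exact abs_edgeWeight_sub_le x
  · have h1 : ∀ y, ¬∃ x, M.emb x = g * M.emb y := fun y ⟨x, hx⟩ =>
      hg ⟨x * y⁻¹, by rw [map_mul, map_inv, hx, mul_inv_cancel_right]⟩
    have h2 : ∀ h, (¬∃ x, M.emb x = h) → M.weight h = 0 := fun h hh =>
      Function.extend_apply' _ _ _ hh
    rw [mul_assoc, ← map_mul, h2 _ hg, h2 _ (h1 _), h2 _ (h1 _)]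
    simp

end BSModel

/-- A model for every index. -/
noncomputable def bsModel : (n : ℕ) → BSModel n
  | 0 => affineModel
  | n + 1 => (bsModel n).succ

/-! ### Short words that are hard to reduce -/

theorem conj_pow_two_pow {G : Type} [Group G] {a t : G} (h : a * t = t * a * a) (T : ℕ) :
    (t ^ T)⁻¹ * a * t ^ T = a ^ 2 ^ T := by
  induction T with
  | zero => simp
  | succ T ih =>
    have h1 : t⁻¹ * a * t⁻¹⁻¹ = a ^ 2 := by
      rw [inv_inv, mul_assoc, h, pow_two]; group
    calc (t ^ (T + 1))⁻¹ * a * t ^ (T + 1)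
        = t⁻¹ * ((t ^ T)⁻¹ * a * t ^ T) * t⁻¹⁻¹ := by rw [pow_succ]; group
      _ = a ^ 2 ^ (T + 1) := by rw [ih, ← conj_pow, h1, ← pow_mul, pow_succ']

theorem rel_of_value_rel {n : ℕ} {G : Type} [Group G] {gen : Fin (n + 2) → G}
    (hgen : ∀ r ∈ iteratedBS (n + 1), value gen r.1 = value gen r.2) (i : Fin (n + 1)) :
    gen i.castSucc * gen i.succ = gen i.succ * gen i.castSucc * gen i.castSucc := by
  have := hgen _ ⟨i, rfl⟩
  simpa only [value_cons _ _ (_ :: _), value_singleton_true, mul_assoc] using this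

/-- Conjugating a_i by a power of a_{i+1} exponentiates the exponent and only about doubles the
word. The absence of a₀ makes the flux vanish along `U`; all groups satisfying the relations are
allowed because both the presented group and the model are used. -/
theorem exists_word_tower (n m : ℕ) (i : Fin (n + 2)) (hi : i ≠ 0) :
    ∃ U : List (Fin (n + 2) × Bool), (∀ x ∈ U, x.1 ≠ 0) ∧
      U.length + 1 = 2 ^ (n + 1 - i.val) * (m + 1) ∧
      ∀ (G : Type) [Group G] (gen : Fin (n + 2) → G),
        (∀ r ∈ iteratedBS (n + 1), value gen r.1 = value gen r.2) →
        value gen U = gen i ^ tower (n + 1 - i.val) m := by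
  induction i using Fin.reverseInduction with
  | last =>
    refine ⟨power (Fin.last _) m, fun x hx => ?_, by simp, fun G _ gen _ => by simp⟩
    rw [List.eq_of_mem_replicate hx]
    exact hi
  | cast i ih =>
    obtain ⟨U, h0, hl, hv⟩ := ih (Fin.succ_ne_zero i)
    have he : n + 1 - i.castSucc.val = n + 1 - i.succ.val + 1 := by
      simp only [Fin.val_castSucc, Fin.val_succ]; omega
    refine ⟨FreeGroup.invRev U ++ [(i.castSucc, true)] ++ U, ?_, ?_, fun G _ gen hgen => ?_⟩
    · intro x hx
      simp only [FreeGroup.invRev, List.mem_append, List.mem_reverse, List.mem_map,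
        List.mem_singleton] at hx
      rcases hx with (⟨y, hy, rfl⟩ | rfl) | hx
      · exact h0 y hy
      · exact hi
      · exact h0 x hx
    · rw [he, pow_succ', mul_assoc, ← hl]
      simp
      omega
    · rw [he, tower_succ, ← conj_pow_two_pow (rel_of_value_rel hgen i)]
      simp only [value_append, value_invRev, value_singleton_true, hv G gen hgen]

/-- The word is the commutator of U⁻¹ a₀ U and a₀ with U = a₁^T, hence of two powers of a₀. -/
theorem exists_hard_word (n m : ℕ) (hm : 1 ≤ tower n m) :
    ∃ w : List (Fin (n + 2) × Bool), w.length = 2 ^ (n + 2) * (m + 1) ∧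
      (∀ (G : Type) [Group G] (gen : Fin (n + 2) → G),
        (∀ r ∈ iteratedBS (n + 1), value gen r.1 = value gen r.2) → value gen w = 1) ∧
      flux (bsModel n).gen (bsModel n).weight 1 w = 2 ^ (tower n m - 1) := by
  obtain ⟨U, h0, hl, hv⟩ := exists_word_tower n m 1 (by simp)
  rw [Fin.val_one, Nat.add_sub_cancel] at hl hv
  have h0' : ∀ x ∈ FreeGroup.invRev U, x.1 ≠ 0 := by
    intro x hx
    simp only [FreeGroup.invRev, List.mem_reverse, List.mem_map] at hx
    obtain ⟨y, hy, rfl⟩ := hx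
    exact h0 y hy
  refine ⟨FreeGroup.invRev U ++ ([(0, true)] ++ (U ++ ([(0, true)] ++ (FreeGroup.invRev U ++
    ([(0, false)] ++ (U ++ [(0, false)])))))), ?_, fun G _ gen hgen => ?_, ?_⟩
  · rw [pow_add, mul_comm (2 ^ n), mul_assoc, ← hl]
    simp
    omega
  · have h1 := conj_pow_two_pow (rel_of_value_rel hgen 0) (tower n m)
    rw [Fin.castSucc_zero, Fin.succ_zero_eq_one, mul_assoc] at h1
    have h2 := conj_pow_two_pow (rel_of_value_rel hgen 0) (tower n m)
    rw [Fin.castSucc_zero, Fin.succ_zero_eq_one] at h2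
    simp only [value_append, value_invRev, value_singleton_true, value_singleton_false,
      hv G gen hgen]
    calc (gen 1 ^ tower n m)⁻¹ * (gen 0 * (gen 1 ^ tower n m * (gen 0 * ((gen 1 ^ tower n m)⁻¹ *
          ((gen 0)⁻¹ * (gen 1 ^ tower n m * (gen 0)⁻¹))))))
        = ((gen 1 ^ tower n m)⁻¹ * gen 0 * gen 1 ^ tower n m) * gen 0 *
          ((gen 1 ^ tower n m)⁻¹ * gen 0 * gen 1 ^ tower n m)⁻¹ * (gen 0)⁻¹ := by group
      _ = 1 := by rw [h2]; group
  · set M := bsModel n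
    have hU : value M.gen U = M.emb ⟨0, -(tower n m : ℤ)⟩ := by
      rw [hv _ M.gen M.value_rel, ← M.emb_contraction, ← map_pow, ← zpow_natCast,
        DyadicAffine.contraction_zpow]
    -- The four a₀-edges start at (shift, exponent) = (0, T), (2^T, 0), (1, T), (0, 0). Only the
    -- first has positive exponent and even shift, so nothing cancels its weight.
    simp only [flux_append, value_invRev, value_singleton_true,
      value_singleton_false, flux_eq_zero M.gen M.weight _ h0,
      flux_eq_zero M.gen M.weight _ h0', hU, flux, ← M.emb_translation, if_true, cond_true,
      cond_false, ← map_mul, ← map_inv, ← map_one M.emb, BSModel.weight_emb]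
    have hz : ∀ x : DyadicAffine, x.exponent = 0 → edgeWeight x = 0 := fun x hx => by
      simp [edgeWeight, hx]
    have hodd : ∀ x : DyadicAffine, x.shift = 1 → edgeWeight x = 0 := fun x hx => by
      rw [edgeWeight, if_neg]
      rintro ⟨-, k, hk⟩
      rw [hx] at hk
      have : (1 : ℤ) = 2 * k := by exact_mod_cast hk
      omega
    generalize tower n m = T at hm
    have hfirst : edgeWeight (1 * (⟨0, -(T : ℤ)⟩ : DyadicAffine)⁻¹) = 2 ^ (T - 1) := by
      rw [edgeWeight, if_pos ⟨by simpa using hm, 0, by simp⟩]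
      congr 1
      simp
    rw [hfirst, hz _ (by simp [DyadicAffine.translation]), hodd _ (by simp [DyadicAffine.translation]),
      hz _ (by simp [DyadicAffine.translation])]
    simp

theorem exists_hard_pair (n m L : ℕ) (hm : 1 ≤ tower n m) (hL : 2 ^ (n + 2) * (m + 1) ≤ L) :
    ∃ w ∈ sector (iteratedBS (n + 1)) 1 L, ∃ w' ∈ sector (iteratedBS (n + 1)) 1 L,
      ((2 ^ (tower n m - 1) : ℕ) : ℕ∞) ≤ dehn (allRelations (iteratedBS (n + 1))) w w' := by
  obtain ⟨w, hl, hv, hf⟩ := exists_hard_word n m hm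
  have hid : ∀ l : List (Fin (n + 2) × Bool), (l.map some).reduceOption = l := fun l => by
    simp [List.reduceOption]
  have hrep : ∀ j, (List.replicate j (none : Letter (Fin (n + 2)))).reduceOption = [] :=
    fun j => by simp [List.reduceOption]
  refine ⟨w.map some ++ List.replicate (L - w.length) none, ⟨?_, ?_⟩,
    List.replicate L none, ⟨?_, ?_⟩, ?_⟩
  · rw [eval_eq_value, List.reduceOption_append, hid, hrep, List.append_nil]
    exact hv _ _ fun r hr => value_of_eq_of_mem hr
  · simp; omega
  · rw [eval_eq_value, hrep, value_nil]
  · simp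
  · have h := natAbs_flux_sub_le_dehn (bsModel n).value_rel (bsModel n).abs_weight_sub_le
      (w.map some ++ List.replicate (L - w.length) none) (List.replicate L none)
    rw [List.reduceOption_append, hid, hrep, hrep, List.append_nil, hf] at h
    simpa [flux, Int.natAbs_pow] using h

/-! ### Towers -/

theorem tower_two_pow (k x : ℕ) : tower k (2 ^ x) = tower (k + 1) x :=
  (Function.iterate_succ_apply _ _ _).symm

theorem tower_strictMono (k : ℕ) : StrictMono (tower k) :=
  StrictMono.iterate (fun _ _ h => Nat.pow_lt_pow_right (by norm_num) h) k

theorem tower_add_le (k x y : ℕ) : tower k x + y ≤ tower k (x + y) := by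
  induction y with
  | zero => simp
  | succ y ih =>
    have := tower_strictMono k (Nat.lt_succ_self (x + y))
    rw [← add_assoc, ← add_assoc]
    exact Nat.succ_le_of_lt (ih.trans_lt this)

theorem one_le_tower (k : ℕ) {x : ℕ} (hx : 1 ≤ x) : 1 ≤ tower k x := by
  cases k with
  | zero => exact hx
  | succ k => rw [tower_succ]; exact Nat.one_le_two_pow

/-- Constant factors outside a tower are absorbed into its argument, so the alphabet size does not
affect the scaling. -/
theorem mul_tower_le (k : ℕ) {c x : ℕ} (hx : 1 ≤ x) :
    c * tower k x ≤ tower k (c * x) := by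
  rcases Nat.eq_zero_or_pos c with rfl | hc
  · simp
  induction k with
  | zero => exact le_rfl
  | succ k ih =>
    rw [tower_succ, tower_succ]
    obtain ⟨d, rfl⟩ : ∃ d, c = d + 1 := ⟨c - 1, by omega⟩
    have h1 : d + 1 ≤ 2 ^ d := Nat.lt_two_pow_self
    have h2 : d ≤ d * tower k x := Nat.le_mul_of_pos_right _ (one_le_tower k hx)
    calc (d + 1) * 2 ^ tower k x ≤ 2 ^ d * 2 ^ tower k x := Nat.mul_le_mul_right _ h1
      _ = 2 ^ (d + tower k x) := (pow_add _ _ _).symm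
      _ ≤ 2 ^ tower k ((d + 1) * x) := by
        refine Nat.pow_le_pow_right (by norm_num) (le_trans ?_ ih)
        rw [add_mul, one_mul]
        omega

theorem tower_le_iterate_exp (k x : ℕ) : (tower k x : ℝ) ≤ Real.exp^[k] x := by
  induction k with
  | zero => simp
  | succ k ih =>
    rw [tower_succ, Function.iterate_succ_apply']
    refine le_trans ?_ (Real.exp_monotone ih)
    rw [← mul_one ((tower k x : ℕ) : ℝ), Real.exp_nat_mul]
    push_cast
    gcongr
    linarith [Real.add_one_le_exp 1]

/-- The factor 2 reproduces itself: 2 e^E ≤ 2^(2E) amounts to log 2 ≤ (2 log 2 - 1) E, which holds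
for E ≥ 2. -/
theorem iterate_exp_le_tower (k x : ℕ) {y : ℝ} (hy : 2 ≤ y) (hx : 2 * y ≤ x) :
    2 ≤ Real.exp^[k] y ∧ 2 * Real.exp^[k] y ≤ tower k x := by
  induction k with
  | zero => exact ⟨hy, hx⟩
  | succ k ih =>
    obtain ⟨h1, h2⟩ := ih
    rw [tower_succ, Function.iterate_succ_apply']
    set E := Real.exp^[k] y
    have hlog := Real.log_two_gt_d9
    have hlog' := Real.log_two_lt_d9
    refine ⟨by linarith [Real.add_one_le_exp E], ?_⟩
    have e1 : ((2 ^ tower k x : ℕ) : ℝ) = Real.exp (tower k x * Real.log 2) := by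
      rw [Real.exp_nat_mul, Real.exp_log two_pos]; push_cast; rfl
    have e2 : 2 * Real.exp E = Real.exp (Real.log 2 + E) := by
      rw [Real.exp_add, Real.exp_log two_pos]
    rw [e1, e2]
    refine Real.exp_monotone ?_
    nlinarith

theorem scalesAs_iterate_exp (k : ℕ) {f : ℕ → ℕ∞} {A B L₀ : ℕ} (hB : 0 < B)
    (hA : ∀ L, 1 ≤ L → f L ≤ (tower k (A * L) : ℕ))
    (hf : ∀ L, L₀ ≤ L → ((tower k (L / B) : ℕ) : ℕ∞) ≤ f L) :
    ScalesAs f (Real.exp^[k]) := by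
  have hmono : Monotone (Real.exp^[k]) := Real.exp_monotone.iterate k
  have hB' : (0 : ℝ) < B := by exact_mod_cast hB
  -- With y = L / (4B), the condition L ≥ 8B gives y ≥ 2, and 2y = L / (2B) leaves room for rounding
  -- L / B down.
  refine ⟨A + 4 * B, by positivity, ?_⟩
  filter_upwards [Filter.eventually_ge_atTop L₀, Filter.eventually_ge_atTop (8 * B)]
    with L hL0 hLB
  constructor
  · have h1 : (L : ℝ) / (A + 4 * B) ≤ L / (4 * B) := by
      gcongr; exact le_add_of_nonneg_left (Nat.cast_nonneg _)
    have hLB' : (8 * B : ℝ) ≤ L := by exact_mod_cast hLB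
    have h2 : (2 : ℝ) ≤ L / (4 * B) := by
      rw [le_div_iff₀ (by positivity)]; linarith
    have h3 : 2 * ((L : ℝ) / (4 * B)) ≤ ((L / B : ℕ) : ℝ) := by
      have h4 : (L : ℝ) < (L / B : ℕ) * B + B := by
        have := Nat.lt_div_mul_add (a := L) hB
        exact_mod_cast this
      have h5 : (L : ℝ) / (4 * B) * B = L / 4 := by field_simp
      by_contra hcon
      push Not at hcon
      have := mul_lt_mul_of_pos_right hcon hB'
      nlinarith
    obtain ⟨h4, h5⟩ := iterate_exp_le_tower k (L / B) h2 h3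
    have h6 : Real.exp^[k] ((L : ℝ) / (A + 4 * B)) ≤ (tower k (L / B) : ℕ) :=
      (hmono h1).trans (by linarith)
    calc ENNReal.ofReal (Real.exp^[k] ((L : ℝ) / (A + 4 * B)))
        ≤ ENNReal.ofReal ((tower k (L / B) : ℕ) : ℝ) := ENNReal.ofReal_le_ofReal h6
      _ = (((tower k (L / B) : ℕ) : ℕ∞) : ENNReal) := by
        rw [ENNReal.ofReal_natCast, ENat.toENNReal_coe]
      _ ≤ f L := ENat.toENNReal_le.2 (hf L hL0)
  · have h1 : (((A * L : ℕ)) : ℝ) ≤ (A + 4 * B) * (L : ℝ) := by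
      push_cast; gcongr; exact le_add_of_nonneg_right (by positivity)
    calc ((f L : ℕ∞) : ENNReal) ≤ (((tower k (A * L) : ℕ) : ℕ∞) : ENNReal) :=
        ENat.toENNReal_le.2 (hA L (by omega))
      _ = ENNReal.ofReal ((tower k (A * L) : ℕ) : ℝ) := by
        rw [ENNReal.ofReal_natCast, ENat.toENNReal_coe]
      _ ≤ _ := ENNReal.ofReal_le_ofReal ((tower_le_iterate_exp _ _).trans (hmono h1))

/-! ### The bounds for the iterated Baumslag–Solitar groups -/

theorem BSModel.Fills.mono {n : ℕ} {M : BSModel n} {F F' : ℕ → ℕ} (h : M.Fills F)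
    (hF : ∀ L, F L ≤ F' L) : M.Fills F' :=
  fun w hw => (h w hw).mono (hF _)

/-- Passing to the next model replaces L by a multiple of 2^L L inside the tower; this is at most 2
to a linear function of L, which adds one storey. -/
theorem exists_bsModel_fills (n : ℕ) :
    ∃ C, (bsModel n).Fills fun L => tower n (C * (L + 1)) := by
  induction n with
  | zero => exact ⟨31, affineModel_fills.mono fun L => by simp; omega⟩
  | succ n ih =>
    obtain ⟨C, hC⟩ := ih
    refine ⟨3 * C + 12, (hC.succ fun x y h =>
      (tower_strictMono n).monotone (by gcongr)).mono fun L => ?_⟩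
    rw [← tower_two_pow]
    rw [add_assoc]
    refine (tower_add_le _ _ _).trans ((tower_strictMono n).monotone ?_)
    have h1 : L ≤ 2 ^ L := Nat.lt_two_pow_self.le
    have h2 : 2 ^ L * L ≤ 4 ^ L := by
      calc 2 ^ L * L ≤ 2 ^ L * 2 ^ L := Nat.mul_le_mul_left _ h1
        _ = 4 ^ L := by rw [← mul_pow]; norm_num
    have h3 : 3 * C + 12 ≤ 2 ^ (3 * C + 12) := Nat.lt_two_pow_self.le
    have h4 : 1 ≤ 4 ^ L := Nat.one_le_pow _ _ (by norm_num)
    calc C * (2 ^ (L + 1) * L + 1) + (7 * 2 ^ L * L + 5)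
        = (2 * C + 7) * (2 ^ L * L) + (C + 5) * 1 := by ring
      _ ≤ (2 * C + 7) * 4 ^ L + (C + 5) * 4 ^ L := by gcongr
      _ = (3 * C + 12) * 4 ^ L := by ring
      _ ≤ 2 ^ (3 * C + 12) * 4 ^ L := Nat.mul_le_mul_right _ h3
      _ = 2 ^ (3 * C + 12 + 2 * L) := by rw [pow_add _ _ (2 * L), pow_mul 2 2 L]; norm_num
      _ ≤ 2 ^ ((3 * C + 12) * (L + 1)) := Nat.pow_le_pow_right (by norm_num) (by nlinarith)

theorem exists_conn_sector (n : ℕ) : ∃ A, 1 ≤ A ∧ ∀ L, 1 ≤ L →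
    ∀ w ∈ sector (iteratedBS (n + 1)) 1 L, ∀ w' ∈ sector (iteratedBS (n + 1)) 1 L,
      Conn (allRelations (iteratedBS (n + 1))) (tower n (A * L)) w w' ∧
        L ≤ tower n (A * L) := by
  obtain ⟨C, hC⟩ := exists_bsModel_fills n
  refine ⟨2 * C + 3, by omega, fun L hL w hw w' hw' => ?_⟩
  have key : ∀ w ∈ sector (iteratedBS (n + 1)) 1 L, w ≠ [] ∧
      Conn (freeRelations (iteratedBS (n + 1))) (tower n (C * (L + 1))) w.reduceOption [] := by
    rintro w ⟨h1, h2⟩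
    refine ⟨by rintro rfl; simp at h2; omega, (hC _ (value_eq_one_of_eval_eq_one _
      (bsModel n).value_rel h1)).mono ((tower_strictMono n).monotone ?_)⟩
    have := List.reduceOption_length_le w
    gcongr
    omega
  have hle : tower n (C * (L + 1)) + (2 * L + 1) ≤ tower n ((2 * C + 3) * L) :=
    (tower_add_le _ _ _).trans ((tower_strictMono n).monotone (by nlinarith))
  have h2 := hw.2
  have h2' := hw'.2
  exact ⟨conn_of_conn_nil (key w hw).1 (key w' hw').1 (key w hw).2 (key w' hw').2 (by omega),
    by omega⟩

theorem add_one_pow_le (q S : ℕ) : (q + 1) ^ S ≤ 2 ^ ((q + 1) * S) := by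
  rw [pow_mul]
  exact Nat.pow_le_pow_left Nat.lt_two_pow_self.le _

theorem exists_dehn_pair (n L : ℕ) (hL : 2 ^ (n + 4) ≤ L) :
    ∃ w ∈ sector (iteratedBS (n + 1)) 1 L, ∃ w' ∈ sector (iteratedBS (n + 1)) 1 L,
      ((2 ^ tower n (L / 2 ^ (n + 3)) : ℕ) : ℕ∞) ≤
        dehn (allRelations (iteratedBS (n + 1))) w w' := by
  have h1 : L / 2 ^ (n + 3) * 2 ^ (n + 3) ≤ L := Nat.div_mul_le_self _ _
  generalize L / 2 ^ (n + 3) = x at h1 ⊢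
  have h2 : 2 ^ (n + 4) = 4 * 2 ^ (n + 2) := by ring
  have h3 : x * 2 ^ (n + 3) = 2 * (x * 2 ^ (n + 2)) := by ring
  have h4 := tower_add_le n x 1
  -- The argument x + 1 compensates for the -1 in the exponent: `tower n (x + 1) - 1 ≥ tower n x`.
  obtain ⟨w, hw, w', hw', h⟩ := exists_hard_pair n (x + 1) L (one_le_tower _ (by omega))
    (by
      have : 2 ^ (n + 2) * (x + 1 + 1) = x * 2 ^ (n + 2) + 2 * 2 ^ (n + 2) := by ring
      omega)
  refine ⟨w, hw, w', hw', le_trans ?_ h⟩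
  exact_mod_cast Nat.pow_le_pow_right (by norm_num) (by omega)

theorem dehnFunction_scalesAs (n : ℕ) :
    ScalesAs (dehnFunction (iteratedBS (n + 1))) (Real.exp^[n + 1]) := by
  obtain ⟨A, hA1, hA⟩ := exists_conn_sector n
  let q := Nat.card (Letter (Fin (n + 2)))
  refine scalesAs_iterate_exp (n + 1) (A := (q + 1) * A) (B := 2 ^ (n + 3)) (L₀ := 2 ^ (n + 4))
    (by positivity) (fun L hL => iSup₂_le fun w hw => iSup₂_le fun w' hw' => ?_) fun L hL => ?_
  · obtain ⟨h1, h2⟩ := hA L hL w hw w' hw'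
    refine (dehn_le_of_conn h1 (hw.2.trans_le h2)).trans ?_
    norm_cast
    refine (add_one_pow_le _ _).trans ?_
    rw [tower_succ]
    refine Nat.pow_le_pow_right (by norm_num) ?_
    rw [mul_assoc]
    exact mul_tower_le n (Nat.mul_pos hA1 hL)
  · obtain ⟨w, hw, w', hw', h⟩ := exists_dehn_pair n L hL
    rw [tower_succ]
    exact h.trans ((le_iSup₂ (f := fun w' _ => dehn _ w w') w' hw').trans
      (le_iSup₂ (f := fun w _ => ⨆ w' ∈ sector (iteratedBS (n + 1)) 1 L, dehn _ w w') w hw))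

theorem expansionLengthFunction_scalesAs (n : ℕ) :
    ScalesAs (expansionLengthFunction (iteratedBS (n + 1))) (Real.exp^[n]) := by
  obtain ⟨A, -, hA⟩ := exists_conn_sector n
  let q := Nat.card (Letter (Fin (n + 2)))
  refine scalesAs_iterate_exp n (A := A) (B := 2 ^ (n + 3) * (q + 1))
    (L₀ := 2 ^ (n + 4) * (q + 1))
    (by positivity) (fun L hL => iSup₂_le fun w hw => iSup₂_le fun w' hw' => ?_) fun L hL => ?_
  · obtain ⟨h1, h2⟩ := hA L hL w hw w' hw'
    exact expansionLength_le h1 (hw.2.trans_le h2)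
  · obtain ⟨w, hw, w', hw', h⟩ := exists_dehn_pair n L
      ((Nat.le_mul_of_pos_right _ (Nat.succ_pos q)).trans hL)
    have hmain : ((tower n (L / (2 ^ (n + 3) * (q + 1))) : ℕ) : ℕ∞) ≤
        expansionLength (allRelations (iteratedBS (n + 1))) w w' := by
      refine le_iInf fun D => ?_
      norm_cast
      -- A derivation in little space could be replaced by one with few steps, so the bound on steps
      -- forces 2^T ≤ (q + 1)^S, where S is the space used by `D`.
      have h1 := h.trans (dehn_le_of_conn D.conn D.length_le_maxLength)
      norm_cast at h1
      have h2 := (Nat.pow_le_pow_iff_right (by norm_num)).1 (h1.trans (add_one_pow_le _ _))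
      rw [← Nat.div_div_eq_div_mul]
      set x := L / 2 ^ (n + 3)
      have hx : q + 1 ≤ x := by
        rw [Nat.le_div_iff_mul_le (by positivity), mul_comm]
        refine le_trans (Nat.mul_le_mul_right _ ?_) hL
        exact Nat.pow_le_pow_right (by norm_num) (by omega)
      have h3 : (q + 1) * tower n (x / (q + 1)) ≤ tower n x :=
        (mul_tower_le n ((Nat.one_le_div_iff (Nat.succ_pos q)).2 hx)).trans
          ((tower_strictMono n).monotone (Nat.mul_div_le _ _))
      exact Nat.le_of_mul_le_mul_left (h3.trans h2) (Nat.succ_pos q)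
    exact hmain.trans ((le_iSup₂ (f := fun w' _ => expansionLength _ w w') w' hw').trans
      (le_iSup₂ (f := fun w _ => ⨆ w' ∈ sector (iteratedBS (n + 1)) 1 L,
        expansionLength _ w w') w hw))

end WordProblem

theorem mainTheorem7 (l : ℕ) (hl : 1 ≤ l) :
    WordProblem.ScalesAs (WordProblem.dehnFunction (WordProblem.iteratedBS l))
        (Real.exp^[l]) ∧
      WordProblem.ScalesAs (WordProblem.expansionLengthFunction (WordProblem.iteratedBS l))
        (Real.exp^[l - 1]) := by
  obtain ⟨n, rfl⟩ : ∃ n, l = n + 1 := ⟨l - 1, by omega⟩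
  exact ⟨WordProblem.dehnFunction_scalesAs n, WordProblem.expansionLengthFunction_scalesAs n⟩
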